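/- Let $d\ge 1$ be an integer, $0<\alpha\le 2$, $0<\beta\le 1$. Let $p_t(x)$, $t>0$, $x\in\mathbb R^d$, be the transition density of the standard (symmetric) $\alpha$-stable Lévy process in $\mathbb R^d$, i.e. $p_t(x)=(2\pi)^{-d}\int_{\mathbb R^d}e^{-i\langle x,y\rangle}e^{-t|y|^\alpha}\,dy$. Put $\psi(z)=|z|^{1+\beta}\bigl(1-i\,\mathrm{sgn}(z)\tan\frac{\pi(1+\beta)}{2}\bigr)$, and let $M$ be an independently scattered, $\sigma$-additive (a.s.) $(1+\beta)$-stable random measure on $\mathbb R\times\mathbb R^d=\mathbb R^{d+1}$ with Lebesgue control measure $\lambda$ and skewness intensity $1$, i.e. $E\,e^{izM(A)}=\exp\{-\lambda(A)\psi(z)\}$ for Borel sets $A$ with $\lambda(A)<\infty$, the values of $M$ on disjoint sets are independent, and $M(\bigcup_j A_j)=\lim_n\sum_{j\le n}M(A_j)$ a.s. for disjoint $A_j$ whose union has finite measure. For $t\ge 0$ consider $$\xi_t=\int_{\mathbb R^{d+1}}\Bigl(\mathbf 1_{[0,t]}(r)\int_r^t p_{u-r}(x)\,du\Bigr)M(dr\,dx),\qquad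 \zeta_t=\int_{\mathbb R^{d+1}}\Bigl(\mathbf 1_{[0,t]}(r)\,p_r^{1/(1+\beta)}(x)\int_r^t p_{u-r}(x)\,du\Bigr)M(dr\,dx).$$ A process $X_t=\int f_t\,dM$, $t\ge 0$, is called well defined if for every $t\ge0$ the integrand $f_t$ makes sense almost everywhere (with finite inner integrals and non-negative bases of powers) and belongs to $L^{1+\beta}(\mathbb R^{d+1})$; there are simple functions $f^{(n)}=\sum_j c_j\mathbf 1_{A_j}$ (finite sums, $A_j$ disjoint, $\lambda(A_j)<\infty$) that converge to $f_t$ a.e. and are dominated in absolute value by one function of $L^{1+\beta}(\mathbb R^{d+1})$; for all such sequences the integrals $\int f^{(n)}\,dM=\sum_j c_jM(A_j)$ converge in probability to one and the same random variable $X_t$, which is thus unique a.s.; and $$E\exp\Bigl\{i\sum_k z_kX_{t_k}\Bigr\}=\exp\Bigl\{-\int_{\mathbb R^{d+1}}\psi\Bigl(\sum_k z_kf_{t_k}(q)\Bigr)dq\Bigr\}$$ for all finite families of distinct times $t_k\ge0$ and of $z_k\in\mathbb R$. Then the process $\xi$ is well defined if $d<\alpha(1+\beta)/\beta$, and the process $\zeta$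 is well defined if $d<\alpha(2+\beta)/(1+\beta)$. -/

import Mathlib

open MeasureTheory ProbabilityTheory Filter Topology

noncomputable section

/-- The function `ψ_a(z) = |z|^a (1 - i sgn(z) tan(π a / 2))`. A stable law of index `a`, unit scale,
skewness one and shift zero has characteristic function `exp(-ψ_a)`. -/
def stableExponent (a z : ℝ) : ℂ :=
  ((|z| ^ a : ℝ) : ℂ) *
    (1 - Complex.I * ((SignType.sign z : ℝ) : ℂ) * ((Real.tan (Real.pi / 2 * a) : ℝ) : ℂ))

/-- `M` is an independently scattered `a`-stable random measure with control measure `m` and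
skewness intensity one. Only the values of `M` on measurable sets of finite `m`-measure matter.
The series in `sigma_additive` is the limit of its partial sums: it need not converge absolutely. -/
structure IsStableRandomMeasure {Ω S : Type*} [MeasurableSpace Ω] [MeasurableSpace S]
    (P : Measure Ω) (m : Measure S) (a : ℝ) (M : Set S → Ω → ℝ) : Prop where
  measurable : ∀ A, MeasurableSet A → m A < ⊤ → Measurable (M A)
  charFun_eq : ∀ A, MeasurableSet A → m A < ⊤ → ∀ z : ℝ,
    charFun (P.map (M A)) z = Complex.exp (-(((m A).toReal : ℝ) : ℂ) * stableExponent a z)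
  independent : ∀ (n : ℕ) (A : Fin n → Set S), (∀ i, MeasurableSet (A i)) → (∀ i, m (A i) < ⊤) →
    Pairwise (fun i j => Disjoint (A i) (A j)) → iIndepFun (fun i => M (A i)) P
  sigma_additive : ∀ A : ℕ → Set S, (∀ i, MeasurableSet (A i)) → m (⋃ i, A i) < ⊤ →
    Pairwise (fun i j => Disjoint (A i) (A j)) →
    ∀ᵐ ω ∂P, Tendsto (fun n => ∑ i ∈ Finset.range n, M (A i) ω) atTop (𝓝 (M (⋃ i, A i) ω))

/-- The integral `∑ c_j M(A_j)` of a simple function `∑ c_j 1_{A_j}` in its canonical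
representation (the value `c = 0` contributes nothing). -/
def simpleStableIntegral {Ω S : Type*} [MeasurableSpace S] (M : Set S → Ω → ℝ)
    (f : SimpleFunc S ℝ) (ω : Ω) : ℝ :=
  ∑ c ∈ f.range, c * M (f ⁻¹' {c}) ω

/-- `F n` is a sequence of simple functions, supported on sets of finite measure, which
converges to `f` almost everywhere and is dominated by a function in `L^a(m)`. -/
structure IsSimpleApprox {S : Type*} [MeasurableSpace S] (m : Measure S) (a : ℝ)
    (f : S → ℝ) (F : ℕ → SimpleFunc S ℝ) : Prop where
  finMeasSupp : ∀ n, (F n).FinMeasSupp m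
  dominated : ∃ g : S → ℝ, MemLp g (ENNReal.ofReal a) m ∧ ∀ n, ∀ᵐ x ∂m, |F n x| ≤ g x
  tendsto_ae : ∀ᵐ x ∂m, Tendsto (fun n => F n x) atTop (𝓝 (f x))

/-- The random variable `Y` is the stable stochastic integral `∫ f dM`: approximating sequences
of simple functions exist, and along each of them the integrals converge to `Y` in probability. -/
structure IsStableIntegral {Ω S : Type*} [MeasurableSpace Ω] [MeasurableSpace S]
    (P : Measure Ω) (m : Measure S) (a : ℝ) (M : Set S → Ω → ℝ) (f : S → ℝ) (Y : Ω → ℝ) :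
    Prop where
  measurable : Measurable Y
  exists_approx : ∃ F, IsSimpleApprox m a f F
  tendsto : ∀ F, IsSimpleApprox m a f F →
    TendstoInMeasure P (fun n => simpleStableIntegral M (F n)) atTop Y

/-- The process `X_t = ∫ f_t dM`, `t ≥ 0`, is well defined: every `f_t` lies in `L^a(m)`, the
integrals exist and are unique almost surely, and the process has the finite-dimensional
distributions `E exp(i ∑ z_k X_{t_k}) = exp(-∫ ψ_a(∑ z_k f_{t_k}) dm)`. -/
def StableIntegralProcessWellDefined {Ω S : Type*} [MeasurableSpace Ω] [MeasurableSpace S]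
    (P : Measure Ω) (m : Measure S) (a : ℝ) (M : Set S → Ω → ℝ) (f : ℝ → S → ℝ) : Prop :=
  (∀ t : ℝ, 0 ≤ t → MemLp (f t) (ENNReal.ofReal a) m) ∧
  ∃ X : ℝ → Ω → ℝ,
    (∀ t : ℝ, 0 ≤ t → IsStableIntegral P m a M (f t) (X t)) ∧
    (∀ X' : ℝ → Ω → ℝ, (∀ t : ℝ, 0 ≤ t → IsStableIntegral P m a M (f t) (X' t)) →
      ∀ t : ℝ, 0 ≤ t → X' t =ᵐ[P] X t) ∧
    (∀ (T : Finset ℝ) (z : ℝ → ℝ), (∀ t ∈ T, 0 ≤ t) →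
      ∫ ω, Complex.exp (Complex.I * ((∑ t ∈ T, z t * X t ω : ℝ) : ℂ)) ∂P =
        Complex.exp (-∫ q, stableExponent a (∑ t ∈ T, z t * f t q) ∂m))

/-- The transition density `p_t(x)` (`t > 0`) of the standard (rotationally symmetric) `α`-stable
Lévy process in `ℝ^d`, whose characteristic function at time `t` is `exp(-t |y|^α)`, given by
Fourier inversion. -/
def stableDensity (d : ℕ) (α t : ℝ) (x : EuclideanSpace ℝ (Fin d)) : ℝ :=
  (((2 * Real.pi) ^ d)⁻¹ : ℝ) *
    (∫ y : EuclideanSpace ℝ (Fin d),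
      Complex.exp (-(Complex.I * ((inner ℝ x y : ℝ) : ℂ))) *
        ((Real.exp (-(t * ‖y‖ ^ α)) : ℝ) : ℂ)).re

/-- `(r, x) ↦ 1_{[0,t]}(r) ∫_r^t p_{u-r}(x) du`. -/
def xiKernel (d : ℕ) (α t : ℝ) (q : ℝ × EuclideanSpace ℝ (Fin d)) : ℝ :=
  (Set.Icc 0 t).indicator (fun r => ∫ u in r..t, stableDensity d α (u - r) q.2) q.1

/-- `(r, x) ↦ 1_{[0,t]}(r) p_r(x)^{1/(1+β)} ∫_r^t p_{u-r}(x) du`. -/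
def zetaKernel (d : ℕ) (α β t : ℝ) (q : ℝ × EuclideanSpace ℝ (Fin d)) : ℝ :=
  (Set.Icc 0 t).indicator
    (fun r => stableDensity d α r q.2 ^ (1 / (1 + β)) *
      ∫ u in r..t, stableDensity d α (u - r) q.2) q.1

end

/-! Write `a = 1 + β`. The argument splits into a soft part and an analytic part.

Soft part (`stableIntegralProcessWellDefined_of_memLp`): membership of every kernel in `L^a`
suffices. For simple functions, independence gives the characteristic function `exp(-∫ ψ_a(zF))`,
and this passes to dominated a.e. limits. If two sequences approximate the same `f`, their
difference approximates `0`, so its characteristic functions tend to `1` and it tends to `0` in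
probability (`IsSimpleApprox.tendstoInMeasure_sub`). This yields at once the Cauchy property, hence
existence, and independence of the approximating sequence. Linearity reduces the finite-dimensional
distributions to the law of a single integral.

Analytic part: only three facts on the density enter, namely `p_u ≥ 0`, `p_u ≤ C u^(-d/α)` and total
mass at most `1`. With `G(x) = ∫_0^t p_u(x) du`, the inner integral of either kernel is at most `G`.
The `a`-th power of the first kernel then integrates to at most `t ∫ G^(1+β)`; for the second,
integrating `p_r(x)` over `r` produces one more factor `G`, hence `∫ G^(2+β)`. By Hölder, `∫ G^b <
∞` if `(d/α)(b-1) < b` (`lintegral_occupationDensity_rpow_lt_top`), and `b = 1+β`, `b = 2+β` turn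
this into the two dimension conditions.

Nonnegativity of `p_t` is the least elementary of the three facts. For `α < 2`, `s^(α/2)` is a
Bernstein function, so `exp(-t s^(α/2))` is a limit of positive multiples of exponentials of Laplace
transforms; at `s = ‖y‖²` these are built from Gaussians, whose Fourier transforms are positive
(`isRadialPositive_exp_neg_rpow`). -/

noncomputable section

/-! ### The stable exponent: growth and continuity. -/

section StableExponent

theorem stableExponent_zero {a : ℝ} (ha : a ≠ 0) : stableExponent a 0 = 0 := by
  simp [stableExponent, Real.zero_rpow ha]

theorem norm_stableExponent_le (a z : ℝ) :
    ‖stableExponent a z‖ ≤ (1 + |Real.tan (Real.pi / 2 * a)|) * |z| ^ a := by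
  unfold stableExponent
  rw [norm_mul, Complex.norm_real, Real.norm_of_nonneg (by positivity), mul_comm]
  gcongr
  refine (norm_sub_le _ _).trans ?_
  rw [norm_one, norm_mul, norm_mul, Complex.norm_I, one_mul, Complex.norm_real, Complex.norm_real,
    Real.norm_eq_abs, Real.norm_eq_abs]
  gcongr
  refine mul_le_of_le_one_left (abs_nonneg _) ?_
  rcases lt_trichotomy z 0 with h | h | h <;> simp [h]

/-- The sign jumps only at `0`, where the factor `|z| ^ a` forces the limit `0`. -/
theorem continuous_stableExponent {a : ℝ} (ha : 0 < a) : Continuous (stableExponent a) := by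
  rw [continuous_iff_continuousAt]
  intro x
  rcases eq_or_ne x 0 with rfl | hx
  · rw [ContinuousAt, stableExponent_zero ha.ne', tendsto_zero_iff_norm_tendsto_zero]
    refine squeeze_zero (fun _ => norm_nonneg _) (norm_stableExponent_le a) ?_
    have h : Continuous fun z : ℝ => (1 + |Real.tan (Real.pi / 2 * a)|) * |z| ^ a := by
      have := (continuous_abs : Continuous fun z : ℝ => |z|).rpow_const (fun _ => Or.inr ha.le)
      exact continuous_const.mul this
    simpa [Real.zero_rpow ha.ne'] using h.tendsto 0
  · unfold stableExponent
    have h1 : ContinuousAt (fun z : ℝ => |z| ^ a) x :=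
      continuous_abs.continuousAt.rpow_const (Or.inr ha.le)
    have h2 : ContinuousAt (fun z : ℝ => ((SignType.sign z : SignType) : ℝ)) x := by
      have : ContinuousAt (SignType.sign : ℝ → SignType) x := continuousAt_sign_of_ne_zero hx
      exact (continuous_of_discreteTopology (f := fun s : SignType => (s : ℝ))).continuousAt.comp
        this
    have h3 := Complex.continuous_ofReal.continuousAt.comp h1
    have h4 := Complex.continuous_ofReal.continuousAt.comp h2
    exact h3.mul (continuousAt_const.sub ((continuousAt_const.mul h4).mul continuousAt_const))

end StableExponent

/-! ### Convergence in probability. -/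

section ConvergenceInMeasure

variable {Ω : Type*} [MeasurableSpace Ω] {P : Measure Ω}

/-- On a finite measure space, convergence in measure means that every subsequence has an a.e.
convergent further subsequence; two successive extractions reduce the claim to sums of real limits.
-/
theorem tendstoInMeasure_add [IsFiniteMeasure P] {U V : ℕ → Ω → ℝ} {X Y : Ω → ℝ}
    (hU : ∀ n, AEStronglyMeasurable (U n) P) (hV : ∀ n, AEStronglyMeasurable (V n) P)
    (hX : TendstoInMeasure P U atTop X) (hY : TendstoInMeasure P V atTop Y) :
    TendstoInMeasure P (fun n ω => U n ω + V n ω) atTop (fun ω => X ω + Y ω) := by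
  refine (exists_seq_tendstoInMeasure_atTop_iff (fun n => (hU n).add (hV n))).2 ?_
  intro ns hns
  obtain ⟨n1, h1, h1'⟩ := (exists_seq_tendstoInMeasure_atTop_iff hU).1 hX ns hns
  obtain ⟨n2, h2, h2'⟩ := (exists_seq_tendstoInMeasure_atTop_iff hV).1 hY _ (hns.comp h1)
  refine ⟨n1 ∘ n2, h1.comp h2, ?_⟩
  filter_upwards [h1', h2'] with ω ha hb
  exact (ha.comp h2.tendsto_atTop).add hb

theorem tendstoInMeasure_const_mul [IsFiniteMeasure P] {U : ℕ → Ω → ℝ} {X : Ω → ℝ} (c : ℝ)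
    (hU : ∀ n, AEStronglyMeasurable (U n) P) (hX : TendstoInMeasure P U atTop X) :
    TendstoInMeasure P (fun n ω => c * U n ω) atTop (fun ω => c * X ω) := by
  refine (exists_seq_tendstoInMeasure_atTop_iff (fun n => (hU n).const_mul c)).2 ?_
  intro ns hns
  obtain ⟨n1, h1, h1'⟩ := (exists_seq_tendstoInMeasure_atTop_iff hU).1 hX ns hns
  refine ⟨n1, h1, ?_⟩
  filter_upwards [h1'] with ω ha
  exact ha.const_mul c

/-- Pointwise convergence of the characteristic functions to `1` is convergence in probability
to `0`. -/
theorem tendstoInMeasure_zero_of_charFun [IsProbabilityMeasure P] {U : ℕ → Ω → ℝ}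
    (hU : ∀ n, Measurable (U n))
    (h : ∀ z, Tendsto (fun n => charFun (P.map (U n)) z) atTop (𝓝 1)) :
    TendstoInMeasure P U atTop (fun _ => 0) := by
  have hp : ∀ n, IsProbabilityMeasure (P.map (U n)) := fun n =>
    Measure.isProbabilityMeasure_map (hU n).aemeasurable
  -- The tail beyond `r` is controlled by the average of `1 - charFun` over `[-2/r, 2/r]`, which
  -- vanishes by bounded convergence.
  have key : ∀ r : ℝ, 0 < r →
      Tendsto (fun n => (P.map (U n)).real {x | r < |x|}) atTop (𝓝 0) := by
    intro r hr
    refine squeeze_zero (fun _ => measureReal_nonneg)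
      (fun n => measureReal_abs_gt_le_integral_charFun hr) ?_
    have h1 : Tendsto (fun n => ∫ t in (-2 * r⁻¹)..(2 * r⁻¹), 1 - charFun (P.map (U n)) t) atTop
        (𝓝 (∫ t in (-2 * r⁻¹)..(2 * r⁻¹), (0 : ℂ))) := by
      refine intervalIntegral.tendsto_integral_filter_of_dominated_convergence (fun _ => 2)
        (Eventually.of_forall fun n => ?_) (Eventually.of_forall fun n => ?_) (by simp) ?_
      · exact (measurable_const.sub measurable_charFun).aestronglyMeasurable
      · refine Eventually.of_forall fun t _ => ?_
        exact norm_one_sub_charFun_le_two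
      · refine Eventually.of_forall fun t _ => ?_
        simpa using (tendsto_const_nhds (x := (1 : ℂ))).sub (h t)
    simpa using (h1.norm.const_mul (2⁻¹ * r))
  rw [tendstoInMeasure_iff_measureReal_norm]
  intro ε hε
  -- The tail estimate has a strict inequality and the goal a weak one; halving `ε` bridges the two.
  refine squeeze_zero (fun _ => measureReal_nonneg) (fun n => ?_) (key (ε / 2) (by positivity))
  rw [map_measureReal_apply (hU n) (measurableSet_lt measurable_const (by fun_prop))]
  refine measureReal_mono ?_ (measure_ne_top _ _)
  intro ω hω
  simp only [Set.mem_ofPred_eq, sub_zero, Real.norm_eq_abs, Set.mem_preimage] at hω ⊢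
  linarith

/-- A sequence that is Cauchy in measure has a subsequence that converges almost surely. -/
theorem exists_subseq_tendsto_ae_of_cauchy {U : ℕ → Ω → ℝ}
    (hU : ∀ n, Measurable (U n))
    (h : ∀ n : ℕ, ∃ k, ∀ i ≥ k, ∀ j ≥ k,
      P {ω | (1 / 2 : ℝ) ^ n ≤ |U i ω - U j ω|} ≤ (1 / 2 : ENNReal) ^ n) :
    ∃ (φ : ℕ → ℕ) (Y : Ω → ℝ), StrictMono φ ∧ Measurable Y ∧
      ∀ᵐ ω ∂P, Tendsto (fun n => U (φ n) ω) atTop (𝓝 (Y ω)) := by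
  obtain ⟨φ, hφ, hP⟩ := extraction_forall_of_eventually
    (P := fun n k => ∀ i ≥ k, ∀ j ≥ k,
      P {ω | (1 / 2 : ℝ) ^ n ≤ |U i ω - U j ω|} ≤ (1 / 2 : ENNReal) ^ n) (by
      intro n
      obtain ⟨k, hk⟩ := h n
      filter_upwards [eventually_ge_atTop k] with m hm i hi j hj
      exact hk i (hm.trans hi) j (hm.trans hj))
  -- Borel–Cantelli: almost surely the increments are eventually below `2^(-n)`.
  have hsum : ∑' n, P {ω | (1 / 2 : ℝ) ^ n ≤ |U (φ n) ω - U (φ (n + 1)) ω|} ≠ ⊤ := by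
    refine ne_top_of_le_ne_top ?_ (ENNReal.tsum_le_tsum fun n =>
      hP n _ le_rfl _ (hφ.monotone (Nat.le_succ n)))
    rw [ENNReal.tsum_geometric]
    simp
  have hlim : ∀ᵐ ω ∂P, ∃ l, Tendsto (fun n => U (φ n) ω) atTop (𝓝 l) := by
    filter_upwards [ae_eventually_notMem hsum] with ω hω
    obtain ⟨N, hN⟩ := eventually_atTop.1 hω
    have hc : CauchySeq fun n => U (φ (n + N)) ω := by
      refine cauchySeq_of_le_geometric (1 / 2) 1 (by norm_num) fun n => ?_
      have h1 := hN (n + N) (Nat.le_add_left _ _)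
      simp only [not_le] at h1
      rw [Real.dist_eq, one_mul, show n + 1 + N = n + N + 1 by ring]
      refine h1.le.trans ?_
      exact pow_le_pow_of_le_one (by norm_num) (by norm_num) (Nat.le_add_right _ _)
    obtain ⟨l, hl⟩ := cauchySeq_tendsto_of_complete hc
    exact ⟨l, (tendsto_add_atTop_iff_nat (f := fun n => U (φ n) ω) N).1 hl⟩
  obtain ⟨Y, hY, hY'⟩ := measurable_limit_of_tendsto_metrizable_ae
    (fun n => (hU (φ n)).aemeasurable) hlim
  exact ⟨φ, Y, hφ, hY, hY'⟩

end ConvergenceInMeasure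

/-! ### Integrals of simple functions: linearity and characteristic function. -/

section SimpleIntegral

variable {Ω S : Type*} [MeasurableSpace Ω] [MeasurableSpace S] {P : Measure Ω}
  {m : Measure S} {a : ℝ} {M : Set S → Ω → ℝ}

namespace IsStableRandomMeasure

/-- For the constant sequence of empty sets the partial sums are `n * M ∅`, which can converge only
if `M ∅ = 0`. -/
theorem ae_empty (hM : IsStableRandomMeasure P m a M) : ∀ᵐ ω ∂P, M ∅ ω = 0 := by
  have h := hM.sigma_additive (fun _ => ∅) (by simp) (by simp) (by intro i j _; simp)
  filter_upwards [h] with ω hω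
  simp only [Finset.sum_const, Finset.card_range, nsmul_eq_mul, Set.iUnion_empty] at hω
  by_contra h0
  have h1 := hω.div_const (M ∅ ω)
  simp only [mul_div_assoc, div_self h0, mul_one] at h1
  exact not_tendsto_nhds_of_tendsto_atTop tendsto_natCast_atTop_atTop _ h1

theorem ae_union (hM : IsStableRandomMeasure P m a M) {A B : Set S} (hA : MeasurableSet A)
    (hB : MeasurableSet B) (hmA : m A < ⊤) (hmB : m B < ⊤) (hAB : Disjoint A B) :
    ∀ᵐ ω ∂P, M (A ∪ B) ω = M A ω + M B ω := by
  let C : ℕ → Set S := fun n => if n = 0 then A else if n = 1 then B else ∅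
  have hU : ⋃ n, C n = A ∪ B := by
    ext x
    simp only [Set.mem_iUnion, Set.mem_union, C]
    constructor
    · rintro ⟨n, hn⟩
      split_ifs at hn <;> simp_all
    · rintro (h | h)
      · exact ⟨0, by simpa⟩
      · exact ⟨1, by simpa⟩
  have h := hM.sigma_additive C (by intro i; dsimp only [C]; split_ifs <;> simp [hA, hB])
    (by rw [hU]; exact measure_union_lt_top hmA hmB) (by
      intro i j hij
      dsimp only [C]
      split_ifs <;> simp_all [hAB.symm])
  filter_upwards [h, hM.ae_empty] with ω hω h0
  rw [hU] at hω
  refine tendsto_nhds_unique hω (tendsto_const_nhds.congr' ?_)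
  filter_upwards [eventually_ge_atTop 2] with n hn
  obtain ⟨k, rfl⟩ := Nat.exists_eq_add_of_le hn
  rw [Finset.sum_range_add, Finset.sum_range_succ, Finset.sum_range_one]
  have : ∑ i ∈ Finset.range k, M (C (2 + i)) ω = 0 := by
    refine Finset.sum_eq_zero fun i _ => ?_
    have : C (2 + i) = ∅ := by simp only [C]; rw [if_neg (by omega), if_neg (by omega)]
    rw [this, h0]
  rw [this]
  simp [C]

theorem ae_biUnion (hM : IsStableRandomMeasure P m a M) {ι : Type*} (s : Finset ι)
    (A : ι → Set S) (hA : ∀ i ∈ s, MeasurableSet (A i)) (hmA : ∀ i ∈ s, m (A i) < ⊤)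
    (hd : (s : Set ι).PairwiseDisjoint A) :
    ∀ᵐ ω ∂P, M (⋃ i ∈ s, A i) ω = ∑ i ∈ s, M (A i) ω := by
  classical
  induction s using Finset.induction_on with
  | empty => simpa using hM.ae_empty
  | insert i s hi ih =>
    have h1 := ih (fun j hj => hA j (Finset.mem_insert_of_mem hj))
      (fun j hj => hmA j (Finset.mem_insert_of_mem hj))
      (hd.subset (by simp))
    have h2 := hM.ae_union (hA i (Finset.mem_insert_self _ _))
      (s.measurableSet_biUnion fun j hj => hA j (Finset.mem_insert_of_mem hj))
      (hmA i (Finset.mem_insert_self _ _))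
      ((measure_biUnion_finset_le s A).trans_lt (ENNReal.sum_lt_top.2
        fun j hj => hmA j (Finset.mem_insert_of_mem hj)))
      (by
        rw [Set.disjoint_iUnion₂_right]
        intro j hj
        exact hd (by simp) (by simp [hj]) (by rintro rfl; exact hi hj))
    filter_upwards [h1, h2] with ω h1 h2
    rw [Finset.set_biUnion_insert, h2, h1, Finset.sum_insert hi]

end IsStableRandomMeasure

theorem measurable_simpleStableIntegral (hM : IsStableRandomMeasure P m a M)
    {F : SimpleFunc S ℝ} (hF : F.FinMeasSupp m) : Measurable (simpleStableIntegral M F) := by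
  refine Finset.measurable_fun_sum _ fun c _ => ?_
  rcases eq_or_ne c 0 with rfl | hc
  · simp
  · exact (hM.measurable _ (F.measurableSet_preimage _)
      (SimpleFunc.finMeasSupp_iff.1 hF c hc)).const_mul c

/-- Additivity of `M` lets the integral be computed on a partition finer than the level sets.
Applied to `F.pair G`, it puts two simple functions on a common partition, which gives additivity of
the integral. Pieces with value `0` may have infinite measure and are not required to be finite. -/
theorem simpleStableIntegral_map (hM : IsStableRandomMeasure P m a M) {γ : Type*}
    (G : SimpleFunc S γ) (φ : γ → ℝ) (hG : ∀ g, φ g ≠ 0 → m (G ⁻¹' {g}) < ⊤) :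
    ∀ᵐ ω ∂P, simpleStableIntegral M (G.map φ) ω = ∑ g ∈ G.range, φ g * M (G ⁻¹' {g}) ω := by
  classical
  have h : ∀ c ∈ (G.map φ).range, ∀ᵐ ω ∂P,
      c * M (G.map φ ⁻¹' {c}) ω = ∑ g ∈ G.range with φ g = c, φ g * M (G ⁻¹' {g}) ω := by
    intro c _
    rcases eq_or_ne c 0 with rfl | hc
    · refine Eventually.of_forall fun ω => ?_
      rw [zero_mul]
      refine (Finset.sum_eq_zero fun g hg => ?_).symm
      rw [(Finset.mem_filter.1 hg).2, zero_mul]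
    · have h1 := hM.ae_biUnion (G.range.filter fun g => φ g = c) (fun g => G ⁻¹' {g})
        (fun g _ => G.measurableSet_preimage _)
        (fun g hg => hG g (by rw [(Finset.mem_filter.1 hg).2]; exact hc))
        (fun g _ g' _ hgg => by
          simp only [Function.onFun]
          exact Disjoint.preimage _ (by simpa using hgg))
      have h2 : (⋃ g ∈ G.range.filter fun g => φ g = c, G ⁻¹' {g}) = G.map φ ⁻¹' {c} := by
        rw [SimpleFunc.map_preimage_singleton]
        ext x
        simp
      rw [h2] at h1
      filter_upwards [h1] with ω hω
      rw [hω, Finset.mul_sum]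
      refine Finset.sum_congr rfl fun g hg => ?_
      rw [(Finset.mem_filter.1 hg).2]
  filter_upwards [(Finset.eventually_all _).2 h] with ω hω
  unfold simpleStableIntegral
  rw [Finset.sum_congr rfl hω]
  refine Finset.sum_fiberwise_of_maps_to (g := φ) (fun g hg => ?_) _
  rw [SimpleFunc.range_map]
  exact Finset.mem_image_of_mem _ hg

theorem simpleStableIntegral_add (hM : IsStableRandomMeasure P m a M) {F G : SimpleFunc S ℝ}
    (hF : F.FinMeasSupp m) (hG : G.FinMeasSupp m) :
    ∀ᵐ ω ∂P, simpleStableIntegral M (F + G) ω =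
      simpleStableIntegral M F ω + simpleStableIntegral M G ω := by
  have hp : (F.pair G).FinMeasSupp m := hF.pair hG
  have hfin : ∀ φ : ℝ × ℝ → ℝ, φ 0 = 0 → ∀ g, φ g ≠ 0 → m (F.pair G ⁻¹' {g}) < ⊤ := by
    intro φ h0 g hg
    refine SimpleFunc.finMeasSupp_iff.1 hp g ?_
    rintro rfl
    exact hg h0
  filter_upwards [simpleStableIntegral_map hM (F.pair G) (fun p => p.1 + p.2)
      (hfin _ (by simp)), simpleStableIntegral_map hM (F.pair G) Prod.fst (hfin _ rfl),
      simpleStableIntegral_map hM (F.pair G) Prod.snd (hfin _ rfl)] with ω h1 h2 h3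
  rw [SimpleFunc.map_fst_pair] at h2
  rw [SimpleFunc.map_snd_pair] at h3
  rw [SimpleFunc.add_eq_map₂, h1, h2, h3, ← Finset.sum_add_distrib]
  exact Finset.sum_congr rfl fun _ _ => by ring

theorem simpleStableIntegral_const_mul (hM : IsStableRandomMeasure P m a M)
    {F : SimpleFunc S ℝ} (hF : F.FinMeasSupp m) (c : ℝ) :
    ∀ᵐ ω ∂P, simpleStableIntegral M (F.map (c * ·)) ω = c * simpleStableIntegral M F ω := by
  filter_upwards [simpleStableIntegral_map hM F (c * ·) (fun g hg =>
    SimpleFunc.finMeasSupp_iff.1 hF g (right_ne_zero_of_mul hg))] with ω h1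
  rw [h1, simpleStableIntegral, Finset.mul_sum]
  exact Finset.sum_congr rfl fun _ _ => by ring

theorem charFun_simpleStableIntegral [IsProbabilityMeasure P] (ha : 0 < a)
    (hM : IsStableRandomMeasure P m a M) {F : SimpleFunc S ℝ} (hF : F.FinMeasSupp m) (z : ℝ) :
    charFun (P.map (simpleStableIntegral M F)) z =
      Complex.exp (-∫ x, stableExponent a (z * F x) ∂m) := by
  classical
  -- The level set of `0` may have infinite measure, so independence is invoked only for the nonzero
  -- values.
  set s := F.range.erase 0 with hs
  let e := s.equivFin.symm
  have hc : ∀ i, (e i : ℝ) ≠ 0 := fun i => (Finset.mem_erase.1 (e i).2).1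
  let A : Fin s.card → Set S := fun i => F ⁻¹' {(e i : ℝ)}
  have hA : ∀ i, MeasurableSet (A i) := fun i => F.measurableSet_preimage _
  have hmA : ∀ i, m (A i) < ⊤ := fun i => SimpleFunc.finMeasSupp_iff.1 hF _ (hc i)
  have hdis : Pairwise fun i j => Disjoint (A i) (A j) := by
    intro i j hij
    refine Disjoint.preimage _ ?_
    rw [Set.disjoint_singleton]
    intro h
    exact hij (e.injective (Subtype.ext h))
  have hI : simpleStableIntegral M F = fun ω => ∑ i, (e i : ℝ) * M (A i) ω := by
    ext ω
    unfold simpleStableIntegral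
    rw [← Finset.sum_erase (a := (0 : ℝ)) F.range (by simp), ← hs, ← Finset.sum_coe_sort s]
    exact (Equiv.sum_comp e fun c : s => (c : ℝ) * M (F ⁻¹' {(c : ℝ)}) ω).symm
  have hind := (hM.independent _ A hA hmA hdis).comp (fun i x => (e i : ℝ) * x)
    (fun i => measurable_const_mul _)
  have hmeas : ∀ i, Measurable (M (A i)) := fun i => hM.measurable _ (hA i) (hmA i)
  have hint : Integrable F m := SimpleFunc.integrable_iff_finMeasSupp.2 hF
  have hψ : stableExponent a (z * 0) = 0 := by rw [mul_zero, stableExponent_zero ha.ne']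
  have hint' : Integrable (F.map fun x => stableExponent a (z * x)) m :=
    SimpleFunc.integrable_iff_finMeasSupp.2 (hF.map hψ)
  have hsum : ∫ x, stableExponent a (z * F x) ∂m =
      ∑ i, m.real (A i) • stableExponent a (z * e i) := by
    have h1 := SimpleFunc.map_integral F (fun x => stableExponent a (z * x)) hint hψ
    rw [SimpleFunc.integral_eq_integral _ hint'] at h1
    simp only [SimpleFunc.map_apply] at h1
    rw [h1, ← Finset.sum_erase (a := (0 : ℝ)) F.range (by rw [hψ, smul_zero]), ← hs,
      ← Finset.sum_coe_sort s]
    exact (Equiv.sum_comp e fun c : s =>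
      m.real (F ⁻¹' {(c : ℝ)}) • stableExponent a (z * (c : ℝ))).symm
  rw [hI, hsum]
  have h2 := iIndepFun.charFun_map_fun_sum_eq_prod
    (fun i => ((hmeas i).const_mul (e i : ℝ)).aemeasurable) hind
  rw [h2, Finset.prod_apply, ← Finset.sum_neg_distrib, Complex.exp_sum]
  refine Finset.prod_congr rfl fun i _ => ?_
  have h3 : P.map (fun ω => (e i : ℝ) * M (A i) ω) =
      (P.map (M (A i))).map (fun x => (e i : ℝ) * x) := by
    rw [Measure.map_map (measurable_const_mul _) (hmeas i)]
    rfl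
  rw [h3, charFun_map_mul, hM.charFun_eq _ (hA i) (hmA i), mul_comm (e i : ℝ) z]
  congr 1
  simp [Measure.real]

end SimpleIntegral

/-! ### The stable integral on `L^a` and the associated process. -/

section StableIntegral

variable {Ω S : Type*} [MeasurableSpace Ω] [MeasurableSpace S] {P : Measure Ω}
  {m : Measure S} {a : ℝ} {M : Set S → Ω → ℝ}

theorem tendsto_integral_stableExponent (ha : 0 < a) {F : ℕ → S → ℝ} {f g : S → ℝ}
    (hF : ∀ n, AEStronglyMeasurable (F n) m) (hg : MemLp g (ENNReal.ofReal a) m)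
    (hFg : ∀ n, ∀ᵐ x ∂m, |F n x| ≤ g x)
    (hlim : ∀ᵐ x ∂m, Tendsto (fun n => F n x) atTop (𝓝 (f x))) :
    Tendsto (fun n => ∫ x, stableExponent a (F n x) ∂m) atTop
      (𝓝 (∫ x, stableExponent a (f x) ∂m)) := by
  have hint := hg.integrable_norm_rpow (by simpa using ha) (by simp)
  rw [ENNReal.toReal_ofReal ha.le] at hint
  refine tendsto_integral_of_dominated_convergence
    (fun x => (1 + |Real.tan (Real.pi / 2 * a)|) * ‖g x‖ ^ a)
    (fun n => (continuous_stableExponent ha).comp_aestronglyMeasurable (hF n))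
    (hint.const_mul _) (fun n => ?_) ?_
  · filter_upwards [hFg n] with x hx
    refine (norm_stableExponent_le _ _).trans ?_
    have : |F n x| ≤ ‖g x‖ := hx.trans (le_abs_self _)
    gcongr
  · filter_upwards [hlim] with x hx
    exact ((continuous_stableExponent ha).tendsto _).comp hx

namespace IsSimpleApprox

theorem add {f g : S → ℝ} {F G : ℕ → SimpleFunc S ℝ} (hF : IsSimpleApprox m a f F)
    (hG : IsSimpleApprox m a g G) :
    IsSimpleApprox m a (fun x => f x + g x) (fun n => F n + G n) where
  finMeasSupp n := (hF.finMeasSupp n).add (hG.finMeasSupp n)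
  dominated := by
    obtain ⟨u, hu, hu'⟩ := hF.dominated
    obtain ⟨v, hv, hv'⟩ := hG.dominated
    refine ⟨fun x => u x + v x, hu.add hv, fun n => ?_⟩
    filter_upwards [hu' n, hv' n] with x h1 h2
    exact (abs_add_le _ _).trans (add_le_add h1 h2)
  tendsto_ae := by
    filter_upwards [hF.tendsto_ae, hG.tendsto_ae] with x h1 h2
    exact h1.add h2

theorem const_mul {f : S → ℝ} {F : ℕ → SimpleFunc S ℝ} (hF : IsSimpleApprox m a f F) (c : ℝ) :
    IsSimpleApprox m a (fun x => c * f x) (fun n => (F n).map (c * ·)) where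
  finMeasSupp n := (hF.finMeasSupp n).map (mul_zero c)
  dominated := by
    obtain ⟨u, hu, hu'⟩ := hF.dominated
    refine ⟨fun x => |c| * u x, hu.const_mul _, fun n => ?_⟩
    filter_upwards [hu' n] with x h1
    rw [SimpleFunc.map_apply, abs_mul]
    gcongr
  tendsto_ae := by
    filter_upwards [hF.tendsto_ae] with x h1
    exact h1.const_mul c

theorem comp {f : S → ℝ} {F : ℕ → SimpleFunc S ℝ} (hF : IsSimpleApprox m a f F) {φ : ℕ → ℕ}
    (hφ : Tendsto φ atTop atTop) : IsSimpleApprox m a f (fun n => F (φ n)) where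
  finMeasSupp n := hF.finMeasSupp _
  dominated := by
    obtain ⟨u, hu, hu'⟩ := hF.dominated
    exact ⟨u, hu, fun n => hu' _⟩
  tendsto_ae := by
    filter_upwards [hF.tendsto_ae] with x h1
    exact h1.comp hφ

theorem tendsto_charFun [IsProbabilityMeasure P] (ha : 0 < a)
    (hM : IsStableRandomMeasure P m a M) {f : S → ℝ} {F : ℕ → SimpleFunc S ℝ}
    (hF : IsSimpleApprox m a f F) (z : ℝ) :
    Tendsto (fun n => charFun (P.map (simpleStableIntegral M (F n))) z) atTop
      (𝓝 (Complex.exp (-∫ x, stableExponent a (z * f x) ∂m))) := by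
  simp_rw [fun n => charFun_simpleStableIntegral ha hM (hF.finMeasSupp n) z]
  have hz := hF.const_mul z
  obtain ⟨g, hg, hFg⟩ := hz.dominated
  exact (Complex.continuous_exp.tendsto _).comp (tendsto_integral_stableExponent ha
    (fun n => (SimpleFunc.aestronglyMeasurable _)) hg hFg hz.tendsto_ae).neg

/-- `F n - G n` is a dominated approximation of `0`, so its characteristic functions tend to `exp 0
= 1`. This replaces any moment or norm estimate for the integral. -/
theorem tendstoInMeasure_sub [IsProbabilityMeasure P] (ha : 0 < a)
    (hM : IsStableRandomMeasure P m a M) {f : S → ℝ} {F G : ℕ → SimpleFunc S ℝ}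
    (hF : IsSimpleApprox m a f F) (hG : IsSimpleApprox m a f G) :
    TendstoInMeasure P
      (fun n ω => simpleStableIntegral M (F n) ω - simpleStableIntegral M (G n) ω) atTop
      (fun _ => 0) := by
  have hH := hF.add (hG.const_mul (-1))
  have h : TendstoInMeasure P
      (fun n => simpleStableIntegral M (F n + (G n).map ((-1 : ℝ) * ·))) atTop (fun _ => 0) := by
    refine tendstoInMeasure_zero_of_charFun
      (fun n => measurable_simpleStableIntegral hM (hH.finMeasSupp n)) fun z => ?_
    have := hH.tendsto_charFun ha hM z
    simpa [stableExponent_zero ha.ne'] using this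
  refine h.congr_left fun n => ?_
  filter_upwards [simpleStableIntegral_add hM (hF.finMeasSupp n)
    ((hG.const_mul (-1)).finMeasSupp n),
    simpleStableIntegral_const_mul hM (hG.finMeasSupp n) (-1)] with ω h1 h2
  rw [h1, h2]
  ring

end IsSimpleApprox

theorem exists_isSimpleApprox (ha : 0 < a) {f : S → ℝ} (hf : MemLp f (ENNReal.ofReal a) m) :
    ∃ F, IsSimpleApprox m a f F := by
  have hm := hf.1.stronglyMeasurable_mk.measurable
  have hf' : MemLp (hf.1.mk f) (ENNReal.ofReal a) m := (memLp_congr_ae hf.1.ae_eq_mk).1 hf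
  have h0 : (0 : ℝ) ∈ (Set.univ : Set ℝ) := Set.mem_univ _
  refine ⟨SimpleFunc.approxOn (hf.1.mk f) hm Set.univ 0 h0, ⟨fun n => ?_, ?_, ?_⟩⟩
  · exact (SimpleFunc.memLp_iff_finMeasSupp (by simpa using ha) (by simp)).1
      (SimpleFunc.memLp_approxOn hm hf' h0 MemLp.zero n)
  · refine ⟨fun x => ‖hf.1.mk f x‖ + ‖hf.1.mk f x‖, hf'.norm.add hf'.norm, fun n => ?_⟩
    exact Eventually.of_forall fun x => SimpleFunc.norm_approxOn_zero_le hm h0 x n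
  · filter_upwards [hf.1.ae_eq_mk] with x hx
    rw [hx]
    exact SimpleFunc.tendsto_approxOn hm h0 (by simp)

namespace IsStableIntegral

/-- One convergent approximating sequence suffices, since any other differs from it by a sequence
tending to `0` in probability. -/
theorem of_approx [IsProbabilityMeasure P] (ha : 0 < a)
    (hM : IsStableRandomMeasure P m a M) {f : S → ℝ} {Y : Ω → ℝ} (hY : Measurable Y)
    {F : ℕ → SimpleFunc S ℝ} (hF : IsSimpleApprox m a f F)
    (h : TendstoInMeasure P (fun n => simpleStableIntegral M (F n)) atTop Y) :
    IsStableIntegral P m a M f Y where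
  measurable := hY
  exists_approx := ⟨F, hF⟩
  tendsto G hG := by
    have hmF := fun n => (measurable_simpleStableIntegral hM (hF.finMeasSupp n))
    have hmG := fun n => (measurable_simpleStableIntegral hM (hG.finMeasSupp n))
    have h1 := tendstoInMeasure_add
      (fun n => ((hmG n).sub (hmF n)).aestronglyMeasurable)
      (fun n => (hmF n).aestronglyMeasurable) (hG.tendstoInMeasure_sub ha hM hF) h
    refine TendstoInMeasure.congr (fun n => ?_) ?_ h1
    · exact Eventually.of_forall fun ω => by simp
    · exact Eventually.of_forall fun ω => by simp

theorem add [IsProbabilityMeasure P] (ha : 0 < a)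
    (hM : IsStableRandomMeasure P m a M) {f g : S → ℝ} {X Y : Ω → ℝ}
    (hX : IsStableIntegral P m a M f X) (hY : IsStableIntegral P m a M g Y) :
    IsStableIntegral P m a M (fun x => f x + g x) (fun ω => X ω + Y ω) := by
  obtain ⟨F, hF⟩ := hX.exists_approx
  obtain ⟨G, hG⟩ := hY.exists_approx
  refine of_approx ha hM (hX.measurable.add hY.measurable) (hF.add hG) ?_
  refine (tendstoInMeasure_add
    (fun n => (measurable_simpleStableIntegral hM (hF.finMeasSupp n)).aestronglyMeasurable)
    (fun n => (measurable_simpleStableIntegral hM (hG.finMeasSupp n)).aestronglyMeasurable)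
    (hX.tendsto F hF) (hY.tendsto G hG)).congr_left fun n => ?_
  filter_upwards [simpleStableIntegral_add hM (hF.finMeasSupp n) (hG.finMeasSupp n)] with ω h
  exact h.symm

theorem const_mul [IsProbabilityMeasure P] (ha : 0 < a)
    (hM : IsStableRandomMeasure P m a M) {f : S → ℝ} {X : Ω → ℝ}
    (hX : IsStableIntegral P m a M f X) (c : ℝ) :
    IsStableIntegral P m a M (fun x => c * f x) (fun ω => c * X ω) := by
  obtain ⟨F, hF⟩ := hX.exists_approx
  refine of_approx ha hM (hX.measurable.const_mul c) (hF.const_mul c) ?_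
  refine (tendstoInMeasure_const_mul c
    (fun n => (measurable_simpleStableIntegral hM (hF.finMeasSupp n)).aestronglyMeasurable)
    (hX.tendsto F hF)).congr_left fun n => ?_
  filter_upwards [simpleStableIntegral_const_mul hM (hF.finMeasSupp n) c] with ω h
  exact h.symm

theorem zero [IsProbabilityMeasure P] (ha : 0 < a) (hM : IsStableRandomMeasure P m a M) :
    IsStableIntegral P m a M (fun _ => 0) (fun _ => 0) := by
  have hF : IsSimpleApprox m a (fun _ => 0) (fun _ => (0 : SimpleFunc S ℝ)) :=
    ⟨fun n => SimpleFunc.finMeasSupp_iff.2 fun y hy => by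
        simp [Set.preimage, hy.symm], ⟨fun _ => 0, MemLp.zero, fun n => by simp⟩, by simp⟩
  refine of_approx ha hM measurable_const hF ?_
  have := hF.tendstoInMeasure_sub (P := P) (M := M) ha hM hF
  refine this.congr_left fun n => ?_
  have h := simpleStableIntegral_const_mul hM (hF.finMeasSupp n) 0
  filter_upwards [h] with ω h
  have h0 : SimpleFunc.map ((0 : ℝ) * ·) (0 : SimpleFunc S ℝ) = 0 := by ext; simp
  rw [h0, zero_mul] at h
  rw [sub_self, h]

theorem sum [IsProbabilityMeasure P] (ha : 0 < a)
    (hM : IsStableRandomMeasure P m a M) {ι : Type*} (T : Finset ι) (z : ι → ℝ)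
    {f : ι → S → ℝ} {X : ι → Ω → ℝ} (hX : ∀ t ∈ T, IsStableIntegral P m a M (f t) (X t)) :
    IsStableIntegral P m a M (fun x => ∑ t ∈ T, z t * f t x)
      (fun ω => ∑ t ∈ T, z t * X t ω) := by
  classical
  induction T using Finset.induction_on with
  | empty => simpa using zero ha hM
  | insert i s hi ih =>
    simp only [Finset.sum_insert hi]
    exact ((hX i (Finset.mem_insert_self _ _)).const_mul ha hM (z i)).add ha hM
      (ih fun t ht => hX t (Finset.mem_insert_of_mem ht))

theorem ae_eq {f : S → ℝ} {X Y : Ω → ℝ} (hX : IsStableIntegral P m a M f X)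
    (hY : IsStableIntegral P m a M f Y) : X =ᵐ[P] Y := by
  obtain ⟨F, hF⟩ := hX.exists_approx
  exact tendstoInMeasure_ae_unique (hX.tendsto F hF) (hY.tendsto F hF)

/-- Along an a.s. convergent subsequence, bounded convergence identifies the left side, and the
limit of characteristic functions at `1` identifies the right side. -/
theorem integral_exp [IsProbabilityMeasure P] (ha : 0 < a)
    (hM : IsStableRandomMeasure P m a M) {f : S → ℝ} {X : Ω → ℝ}
    (hX : IsStableIntegral P m a M f X) :
    ∫ ω, Complex.exp (Complex.I * ((X ω : ℝ) : ℂ)) ∂P =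
      Complex.exp (-∫ q, stableExponent a (f q) ∂m) := by
  obtain ⟨F, hF⟩ := hX.exists_approx
  obtain ⟨φ, hφ, hφ'⟩ := (hX.tendsto F hF).exists_seq_tendsto_ae
  have hF' := hF.comp hφ.tendsto_atTop
  have hm := fun n => measurable_simpleStableIntegral hM (hF'.finMeasSupp n)
  have h1 : Tendsto (fun n => ∫ ω, Complex.exp
      (Complex.I * ((simpleStableIntegral M (F (φ n)) ω : ℝ) : ℂ)) ∂P) atTop
      (𝓝 (∫ ω, Complex.exp (Complex.I * ((X ω : ℝ) : ℂ)) ∂P)) := by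
    have hc : Continuous fun x : ℝ => Complex.exp (Complex.I * (x : ℂ)) := by fun_prop
    refine tendsto_integral_of_dominated_convergence (fun _ => 1)
      (fun n => (hc.measurable.comp (hm n)).aestronglyMeasurable) (by simp)
      (fun n => Eventually.of_forall fun ω => ?_) ?_
    · rw [mul_comm, Complex.norm_exp_ofReal_mul_I]
    · filter_upwards [hφ'] with ω hω
      exact (hc.tendsto _).comp hω
  have h2 := hF'.tendsto_charFun ha hM 1
  refine tendsto_nhds_unique h1 ?_
  simp only [one_mul] at h2
  refine h2.congr fun n => ?_
  rw [charFun_apply_real, integral_map (hm n).aemeasurable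
    (by fun_prop : Continuous fun x : ℝ =>
      Complex.exp (((1 : ℝ) : ℂ) * (x : ℂ) * Complex.I)).aestronglyMeasurable]
  refine integral_congr_ae (Eventually.of_forall fun ω => ?_)
  simp [mul_comm]

end IsStableIntegral

theorem exists_isStableIntegral [IsProbabilityMeasure P] (ha : 0 < a)
    (hM : IsStableRandomMeasure P m a M) {f : S → ℝ} (hf : MemLp f (ENNReal.ofReal a) m) :
    ∃ Y, IsStableIntegral P m a M f Y := by
  obtain ⟨F, hF⟩ := exists_isSimpleApprox ha hf
  have hm := fun n => measurable_simpleStableIntegral hM (hF.finMeasSupp n)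
  have hC : ∀ n : ℕ, ∃ k, ∀ i ≥ k, ∀ j ≥ k,
      P {ω | (1 / 2 : ℝ) ^ n ≤ |simpleStableIntegral M (F i) ω - simpleStableIntegral M (F j) ω|}
        ≤ (1 / 2 : ENNReal) ^ n := by
    intro n
    -- Failure at level `n` gives indices `i k, j k ≥ k` with a large difference for every `k`. Both
    -- `F ∘ i` and `F ∘ j` still approximate `f`, so their difference must tend to `0` in
    -- probability.
    by_contra! hcon
    choose i hi j hj hij using hcon
    have h1 := (hF.comp (tendsto_atTop_mono hi tendsto_id)).tendstoInMeasure_sub (P := P) ha hM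
      (hF.comp (tendsto_atTop_mono hj tendsto_id))
    rw [tendstoInMeasure_iff_norm] at h1
    have h2 := h1 ((1 / 2 : ℝ) ^ n) (by positivity)
    simp only [sub_zero, Real.norm_eq_abs] at h2
    have h3 : (0 : ENNReal) < (1 / 2 : ENNReal) ^ n := by
      refine ENNReal.pow_pos ?_ n
      simp
    obtain ⟨k, hk⟩ := (h2.eventually_lt_const h3).exists
    exact absurd (hij k) (not_lt.2 hk.le)
  obtain ⟨φ, Y, hφ, hY, hlim⟩ := exists_subseq_tendsto_ae_of_cauchy hm hC
  exact ⟨Y, IsStableIntegral.of_approx ha hM hY (hF.comp hφ.tendsto_atTop)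
    (tendstoInMeasure_of_tendsto_ae (fun n => (hm _).aestronglyMeasurable) hlim)⟩

theorem stableIntegralProcessWellDefined_of_memLp [IsProbabilityMeasure P] (ha : 0 < a)
    (hM : IsStableRandomMeasure P m a M) {f : ℝ → S → ℝ}
    (hf : ∀ t, 0 ≤ t → MemLp (f t) (ENNReal.ofReal a) m) :
    StableIntegralProcessWellDefined P m a M f := by
  have h : ∀ t : ℝ, ∃ Y, 0 ≤ t → IsStableIntegral P m a M (f t) Y := by
    intro t
    by_cases ht : 0 ≤ t
    · obtain ⟨Y, hY⟩ := exists_isStableIntegral ha hM (hf t ht)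
      exact ⟨Y, fun _ => hY⟩
    · exact ⟨fun _ => 0, fun h => absurd h ht⟩
  choose X hX using h
  exact ⟨hf, X, hX, fun X' hX' t ht => (hX' t ht).ae_eq (hX t ht),
    fun T z hT => (IsStableIntegral.sum ha hM T z fun t ht => hX t (hT t ht)).integral_exp ha hM⟩

end StableIntegral

/-! ### Radial functions with nonnegative Fourier transform. -/

section PositiveDefinite

variable {V : Type*} [NormedAddCommGroup V] [InnerProductSpace ℝ V] [FiniteDimensional ℝ V]
  [MeasurableSpace V] [BorelSpace V]

theorem integrable_exp_neg_mul_sq_norm {δ : ℝ} (hδ : 0 < δ) :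
    Integrable fun y : V => Real.exp (-δ * ‖y‖ ^ 2) := by
  have h := (GaussianFourier.integrable_cexp_neg_mul_sq_norm_add (V := V) (b := (δ : ℂ))
    (by simpa using hδ) 0 0).norm
  refine h.congr (Eventually.of_forall fun y => ?_)
  simp only [zero_mul, add_zero, Complex.norm_exp]
  norm_cast

theorem integral_exp_neg_mul_sq_norm_mul_cos {δ : ℝ} (hδ : 0 < δ) (x : V) :
    ∫ y : V, Real.exp (-δ * ‖y‖ ^ 2) * Real.cos (inner ℝ x y) =
      (Real.pi / δ) ^ ((Module.finrank ℝ V : ℝ) / 2) * Real.exp (-(4 * δ)⁻¹ * ‖x‖ ^ 2) := by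
  have hδ' : 0 < ((δ : ℂ)).re := by simpa using hδ
  have h1 := integral_re (𝕜 := ℂ)
    (GaussianFourier.integrable_cexp_neg_mul_sq_norm_add hδ' Complex.I x)
  rw [GaussianFourier.integral_cexp_neg_mul_sq_norm_add hδ' Complex.I x] at h1
  have h2 : ∀ y : V, RCLike.re (Complex.exp (-(δ : ℂ) * ‖y‖ ^ 2 +
      Complex.I * ((inner ℝ x y : ℝ) : ℂ))) =
      Real.exp (-δ * ‖y‖ ^ 2) * Real.cos (inner ℝ x y) := by
    intro y
    rw [Complex.exp_add, mul_comm Complex.I]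
    have : Complex.exp (-(δ : ℂ) * ‖y‖ ^ 2) = ((Real.exp (-δ * ‖y‖ ^ 2) : ℝ) : ℂ) := by
      push_cast; rfl
    rw [this]
    simp only [RCLike.re_eq_complex_re]
    rw [Complex.re_ofReal_mul, Complex.exp_ofReal_mul_I_re]
  simp only [h2] at h1
  rw [h1]
  have h3 : ((Real.pi : ℂ) / δ) ^ ((Module.finrank ℝ V : ℂ) / 2) *
      Complex.exp (Complex.I ^ 2 * (‖x‖ : ℂ) ^ 2 / (4 * δ)) =
      (((Real.pi / δ) ^ ((Module.finrank ℝ V : ℝ) / 2) *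
        Real.exp (-(4 * δ)⁻¹ * ‖x‖ ^ 2) : ℝ) : ℂ) := by
    push_cast
    rw [Complex.ofReal_cpow (by positivity)]
    push_cast
    congr 2
    rw [Complex.I_sq]
    field_simp
  rw [h3]
  simp only [RCLike.re_eq_complex_re, Complex.ofReal_re]

variable (V) in
/-- `h` is a bounded function on `[0, ∞)` such that every Gaussian regularization of the radial
function `y ↦ h(‖y‖²)` on `V` has a nonnegative Fourier transform. -/
structure IsRadialPositive (h : ℝ → ℝ) : Prop where
  measurable : Measurable h
  bounded : ∃ C, ∀ s, 0 ≤ s → |h s| ≤ C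
  nonneg : ∀ δ : ℝ, 0 < δ → ∀ x : V,
    0 ≤ ∫ y : V, h (‖y‖ ^ 2) * Real.exp (-δ * ‖y‖ ^ 2) * Real.cos (inner ℝ x y)

theorem integrable_mul_exp_mul_cos {h : ℝ → ℝ} (hm : Measurable h)
    (hb : ∃ C, ∀ s, 0 ≤ s → |h s| ≤ C) {δ : ℝ} (hδ : 0 < δ) (x : V) :
    Integrable fun y : V => h (‖y‖ ^ 2) * Real.exp (-δ * ‖y‖ ^ 2) * Real.cos (inner ℝ x y) := by
  obtain ⟨C, hC⟩ := hb
  refine ((integrable_exp_neg_mul_sq_norm (V := V) hδ).const_mul C).mono'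
    (by fun_prop) (Eventually.of_forall fun y => ?_)
  rw [norm_mul, norm_mul, Real.norm_eq_abs, Real.norm_eq_abs, Real.norm_eq_abs, Real.abs_exp]
  have h1 := hC (‖y‖ ^ 2) (by positivity)
  have h2 := Real.abs_cos_le_one (inner ℝ x y)
  have h3 := Real.exp_pos (-δ * ‖y‖ ^ 2)
  calc |h (‖y‖ ^ 2)| * Real.exp (-δ * ‖y‖ ^ 2) * |Real.cos (inner ℝ x y)|
      ≤ |h (‖y‖ ^ 2)| * Real.exp (-δ * ‖y‖ ^ 2) * 1 := by gcongr
    _ ≤ _ := by rw [mul_one]; gcongr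

namespace IsRadialPositive

theorem one : IsRadialPositive V fun _ => 1 where
  measurable := measurable_const
  bounded := ⟨1, by simp⟩
  nonneg δ hδ x := by
    simp only [one_mul]
    rw [integral_exp_neg_mul_sq_norm_mul_cos hδ]
    positivity

theorem add {h k : ℝ → ℝ} (hh : IsRadialPositive V h) (hk : IsRadialPositive V k) :
    IsRadialPositive V fun s => h s + k s where
  measurable := hh.measurable.add hk.measurable
  bounded := by
    obtain ⟨C, hC⟩ := hh.bounded
    obtain ⟨D, hD⟩ := hk.bounded
    exact ⟨C + D, fun s hs => (abs_add_le _ _).trans (add_le_add (hC s hs) (hD s hs))⟩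
  nonneg δ hδ x := by
    simp only [add_mul]
    rw [integral_add (integrable_mul_exp_mul_cos hh.measurable hh.bounded hδ x)
      (integrable_mul_exp_mul_cos hk.measurable hk.bounded hδ x)]
    exact add_nonneg (hh.nonneg δ hδ x) (hk.nonneg δ hδ x)

theorem const_mul {h : ℝ → ℝ} (hh : IsRadialPositive V h) {c : ℝ} (hc : 0 ≤ c) :
    IsRadialPositive V fun s => c * h s where
  measurable := hh.measurable.const_mul c
  bounded := by
    obtain ⟨C, hC⟩ := hh.bounded
    refine ⟨c * C, fun s hs => ?_⟩
    rw [abs_mul, abs_of_nonneg hc]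
    exact mul_le_mul_of_nonneg_left (hC s hs) hc
  nonneg δ hδ x := by
    simp only [mul_assoc c]
    rw [integral_const_mul]
    exact mul_nonneg hc (hh.nonneg δ hδ x)

/-- Bounded pointwise limits. -/
theorem of_tendsto {h : ℕ → ℝ → ℝ} {k : ℝ → ℝ} (hh : ∀ n, IsRadialPositive V (h n))
    (hk : Measurable k) {C : ℝ} (hC : ∀ n s, 0 ≤ s → |h n s| ≤ C)
    (hlim : ∀ s, 0 ≤ s → Tendsto (fun n => h n s) atTop (𝓝 (k s))) :
    IsRadialPositive V k where
  measurable := hk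
  bounded := ⟨C, fun s hs => le_of_tendsto (hlim s hs).abs
    (Eventually.of_forall fun n => hC n s hs)⟩
  nonneg δ hδ x := by
    refine ge_of_tendsto' (tendsto_integral_of_dominated_convergence
      (fun y : V => C * Real.exp (-δ * ‖y‖ ^ 2))
      (fun n => (integrable_mul_exp_mul_cos (hh n).measurable (hh n).bounded hδ x).1)
      ((integrable_exp_neg_mul_sq_norm (V := V) hδ).const_mul C)
      (fun n => Eventually.of_forall fun y => ?_)
      (Eventually.of_forall fun y =>
        ((hlim (‖y‖ ^ 2) (by positivity)).mul_const _).mul_const _))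
      fun n => (hh n).nonneg δ hδ x
    rw [norm_mul, norm_mul, Real.norm_eq_abs, Real.norm_eq_abs, Real.norm_eq_abs, Real.abs_exp]
    have h1 := hC n (‖y‖ ^ 2) (by positivity)
    have h2 := Real.abs_cos_le_one (inner ℝ x y)
    calc |h n (‖y‖ ^ 2)| * Real.exp (-δ * ‖y‖ ^ 2) * |Real.cos (inner ℝ x y)|
        ≤ |h n (‖y‖ ^ 2)| * Real.exp (-δ * ‖y‖ ^ 2) * 1 := by gcongr
      _ ≤ _ := by rw [mul_one]; gcongr

theorem measurable_laplace (μ : Measure ℝ) [SFinite μ] {w : ℝ → ℝ} (hw : Measurable w) :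
    Measurable fun s => ∫ l, Real.exp (-l * s) * w l ∂μ := by
  have h : StronglyMeasurable (Function.uncurry fun s l : ℝ => Real.exp (-l * s) * w l) :=
    Measurable.stronglyMeasurable (by unfold Function.uncurry; fun_prop)
  exact h.integral_prod_right.measurable

theorem abs_laplace_le (μ : Measure ℝ) {w : ℝ → ℝ} (hint : Integrable w μ)
    (hw0 : ∀ᵐ l ∂μ, 0 ≤ w l) (hl : ∀ᵐ l ∂μ, 0 ≤ l) (s : ℝ) (hs : 0 ≤ s) :
    |∫ l, Real.exp (-l * s) * w l ∂μ| ≤ ∫ l, w l ∂μ := by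
  rw [← Real.norm_eq_abs]
  refine norm_integral_le_of_norm_le hint ?_
  filter_upwards [hw0, hl] with l h1 h2
  rw [norm_mul, Real.norm_eq_abs, Real.norm_eq_abs, Real.abs_exp, abs_of_nonneg h1]
  refine mul_le_of_le_one_left h1 (Real.exp_le_one_iff.2 ?_)
  nlinarith

/-- Multiplication by a Laplace transform. -/
theorem laplace_mul {h : ℝ → ℝ} (hh : IsRadialPositive V h) (μ : Measure ℝ) [SFinite μ]
    {w : ℝ → ℝ} (hw : Measurable w) (hint : Integrable w μ) (hw0 : ∀ᵐ l ∂μ, 0 ≤ w l)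
    (hl : ∀ᵐ l ∂μ, 0 ≤ l) :
    IsRadialPositive V fun s => (∫ l, Real.exp (-l * s) * w l ∂μ) * h s where
  measurable := (measurable_laplace μ hw).mul hh.measurable
  bounded := by
    obtain ⟨C, hC⟩ := hh.bounded
    refine ⟨(∫ l, w l ∂μ) * C, fun s hs => ?_⟩
    rw [abs_mul]
    exact mul_le_mul (abs_laplace_le μ hint hw0 hl s hs) (hC s hs) (abs_nonneg _)
      (integral_nonneg_of_ae hw0)
  nonneg δ hδ x := by
    have hhm := hh.measurable
    -- The factor `exp(-l ‖y‖²)` only changes the Gaussian parameter from `δ` to `δ + l`, so after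
    -- Fubini the positivity of `h` applies for each `l`. This is why positivity is demanded for
    -- every `δ > 0`.
    let f : V → ℝ → ℝ := fun y l => w l * (h (‖y‖ ^ 2) * Real.exp (-(δ + l) * ‖y‖ ^ 2) *
      Real.cos (inner ℝ x y))
    have e1 : ∀ y : V, (∫ l, Real.exp (-l * ‖y‖ ^ 2) * w l ∂μ) * h (‖y‖ ^ 2) *
        Real.exp (-δ * ‖y‖ ^ 2) * Real.cos (inner ℝ x y) = ∫ l, f y l ∂μ := by
      intro y
      rw [mul_assoc, mul_assoc, ← integral_mul_const]
      refine integral_congr_ae (Eventually.of_forall fun l => ?_)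
      simp only [f]
      rw [show -(δ + l) * ‖y‖ ^ 2 = -δ * ‖y‖ ^ 2 + -l * ‖y‖ ^ 2 by ring, Real.exp_add]
      ring
    simp only [e1]
    have hf : Integrable (Function.uncurry f) ((volume : Measure V).prod μ) := by
      have h0 := (integrable_mul_exp_mul_cos (V := V) hh.measurable hh.bounded hδ x).norm.mul_prod
        hint.norm
      refine h0.mono' ?_ ?_
      · refine Measurable.aestronglyMeasurable ?_
        unfold Function.uncurry
        simp only [f]
        fun_prop
      · have hl' : ∀ᵐ z ∂((volume : Measure V).prod μ), 0 ≤ z.2 :=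
          Measure.quasiMeasurePreserving_snd.ae hl
        filter_upwards [hl'] with z hz
        obtain ⟨y, l⟩ := z
        simp only [Function.uncurry, f, norm_mul, Real.norm_eq_abs, Real.abs_exp]
        have : Real.exp (-(δ + l) * ‖y‖ ^ 2) ≤ Real.exp (-δ * ‖y‖ ^ 2) := by
          refine Real.exp_le_exp.2 ?_
          have : 0 ≤ l * ‖y‖ ^ 2 := mul_nonneg hz (by positivity)
          linarith
        rw [mul_comm]
        gcongr
    rw [integral_integral_swap hf]
    refine integral_nonneg_of_ae ?_
    filter_upwards [hw0, hl] with l h1 h2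
    simp only [f, Pi.zero_apply]
    rw [integral_const_mul]
    exact mul_nonneg h1 (hh.nonneg (δ + l) (by linarith) x)

/-- The exponential of a Laplace transform, as the limit of `(1 + g / n) ^ n`. -/
theorem exp_laplace (μ : Measure ℝ) [SFinite μ]
    {w : ℝ → ℝ} (hw : Measurable w) (hint : Integrable w μ) (hw0 : ∀ᵐ l ∂μ, 0 ≤ w l)
    (hl : ∀ᵐ l ∂μ, 0 ≤ l) :
    IsRadialPositive V fun s => Real.exp (∫ l, Real.exp (-l * s) * w l ∂μ) := by
  set g : ℝ → ℝ := fun s => ∫ l, Real.exp (-l * s) * w l ∂μ with hg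
  have hpow : ∀ (n : ℕ) (c : ℝ), 0 ≤ c → IsRadialPositive V fun s => (1 + c * g s) ^ n := by
    intro n c hc
    induction n with
    | zero => simpa using one
    | succ n ih =>
      have h1 := ih.add ((ih.laplace_mul μ hw hint hw0 hl).const_mul hc)
      have e : (fun s => (1 + c * g s) ^ (n + 1)) =
          fun s => (1 + c * g s) ^ n + c * (g s * (1 + c * g s) ^ n) := by
        funext s
        ring
      rw [e]
      exact h1
  have hg0 : ∀ s, 0 ≤ g s := fun s => by
    refine integral_nonneg_of_ae ?_
    filter_upwards [hw0] with l h
    exact mul_nonneg (Real.exp_pos _).le h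
  refine of_tendsto (h := fun n s => (1 + (n : ℝ)⁻¹ * g s) ^ n)
    (C := Real.exp (∫ l, w l ∂μ))
    (fun n => hpow n _ (by positivity)) (Real.measurable_exp.comp (measurable_laplace μ hw))
    (fun n s hs => ?_) (fun s _ => ?_)
  · have h0 := hg0 s
    rw [abs_of_nonneg (by positivity)]
    rcases Nat.eq_zero_or_pos n with rfl | hn
    · simpa using integral_nonneg_of_ae hw0
    have hn' : (n : ℝ) ≠ 0 := by positivity
    calc (1 + (n : ℝ)⁻¹ * g s) ^ n ≤ (Real.exp ((n : ℝ)⁻¹ * g s)) ^ n := by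
          gcongr
          rw [add_comm]
          exact Real.add_one_le_exp _
      _ = Real.exp (g s) := by rw [← Real.exp_nat_mul]; congr 1; field_simp
      _ ≤ _ := Real.exp_le_exp.2 ((le_abs_self _).trans (abs_laplace_le μ hint hw0 hl s hs))
  · have := Real.tendsto_one_add_div_pow_exp (g s)
    refine this.congr fun n => ?_
    rw [div_eq_inv_mul]

end IsRadialPositive

/-- Near `0`, `1 - exp(-l) ≤ l` leaves `l ^ (-γ)`, integrable as `γ < 1`; beyond `1` the bound `1`
leaves `l ^ (-1 - γ)`, integrable as `γ > 0`. -/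
theorem integrableOn_one_sub_exp_mul_rpow {γ : ℝ} (h0 : 0 < γ) (h1 : γ < 1) :
    IntegrableOn (fun l : ℝ => (1 - Real.exp (-l)) * l ^ (-1 - γ)) (Set.Ioi 0) := by
  have hm : Measurable fun l : ℝ => (1 - Real.exp (-l)) * l ^ (-1 - γ) := by fun_prop
  rw [← Set.Ioc_union_Ioi_eq_Ioi (zero_le_one (α := ℝ))]
  refine IntegrableOn.union ?_ ?_
  · have hi : IntegrableOn (fun l : ℝ => l ^ (-γ)) (Set.Ioc 0 1) :=
      (intervalIntegrable_iff_integrableOn_Ioc_of_le zero_le_one).1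
        (intervalIntegral.intervalIntegrable_rpow' (by linarith))
    refine Integrable.mono' hi hm.aestronglyMeasurable ?_
    filter_upwards [ae_restrict_mem measurableSet_Ioc] with l hl
    have h2 : Real.exp (-l) ≤ 1 := Real.exp_le_one_iff.2 (by linarith [hl.1])
    have h3 := Real.add_one_le_exp (-l)
    have h4 : 0 ≤ l ^ (-1 - γ) := Real.rpow_nonneg hl.1.le _
    rw [Real.norm_of_nonneg (mul_nonneg (by linarith) h4)]
    calc (1 - Real.exp (-l)) * l ^ (-1 - γ) ≤ l * l ^ (-1 - γ) := by gcongr; linarith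
      _ = l ^ (-γ) := by
        rw [← Real.rpow_one_add' hl.1.le (by linarith)]
        congr 1; ring
  · refine Integrable.mono' (integrableOn_Ioi_rpow_of_lt (a := -1 - γ) (by linarith) one_pos)
      hm.aestronglyMeasurable ?_
    filter_upwards [ae_restrict_mem measurableSet_Ioi] with l hl
    have hl' : (0 : ℝ) < l := one_pos.trans hl
    have h2 : Real.exp (-l) ≤ 1 := Real.exp_le_one_iff.2 (by linarith)
    have h3 := Real.exp_pos (-l)
    have h4 : 0 ≤ l ^ (-1 - γ) := Real.rpow_nonneg hl'.le _
    rw [Real.norm_of_nonneg (mul_nonneg (by linarith) h4)]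
    exact mul_le_of_le_one_left h4 (by linarith)

/-- `s ^ γ` is a Bernstein function with the Lévy density `l ^ (-1 - γ)`, up to a factor. -/
theorem integral_one_sub_exp_mul_rpow {γ : ℝ} (h0 : 0 < γ) {s : ℝ} (hs : 0 ≤ s) :
    ∫ l in Set.Ioi (0 : ℝ), (1 - Real.exp (-l * s)) * l ^ (-1 - γ) =
      s ^ γ * ∫ l in Set.Ioi (0 : ℝ), (1 - Real.exp (-l)) * l ^ (-1 - γ) := by
  rcases hs.eq_or_lt with rfl | hs
  · simp [Real.zero_rpow h0.ne']
  have h := integral_comp_mul_left_Ioi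
    (fun l : ℝ => (1 - Real.exp (-l)) * l ^ (-1 - γ)) 0 hs
  rw [mul_zero] at h
  have h2 : ∫ l in Set.Ioi (0 : ℝ), (1 - Real.exp (-(s * l))) * (s * l) ^ (-1 - γ) =
      s ^ (-1 - γ) * ∫ l in Set.Ioi (0 : ℝ), (1 - Real.exp (-l * s)) * l ^ (-1 - γ) := by
    rw [← integral_const_mul]
    refine setIntegral_congr_fun measurableSet_Ioi fun l hl => ?_
    rw [Real.mul_rpow hs.le (le_of_lt hl), neg_mul, mul_comm l s]
    ring
  rw [h2, smul_eq_mul] at h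
  have h3 : s ^ (1 + γ) * s ^ (-1 - γ) = 1 := by
    rw [← Real.rpow_add hs, show 1 + γ + (-1 - γ) = 0 by ring, Real.rpow_zero]
  have h4 : s ^ (1 + γ) * s⁻¹ = s ^ γ := by
    rw [← Real.rpow_neg_one, ← Real.rpow_add hs]
    congr 1; ring
  calc _ = s ^ (1 + γ) * (s ^ (-1 - γ) *
        ∫ l in Set.Ioi (0 : ℝ), (1 - Real.exp (-l * s)) * l ^ (-1 - γ)) := by
        rw [← mul_assoc, h3, one_mul]
    _ = _ := by rw [h, ← mul_assoc, h4]

theorem integral_one_sub_exp_mul_rpow_pos {γ : ℝ} (h0 : 0 < γ) (h1 : γ < 1) :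
    0 < ∫ l in Set.Ioi (0 : ℝ), (1 - Real.exp (-l)) * l ^ (-1 - γ) := by
  have hpos : ∀ l ∈ Set.Ioi (0 : ℝ), 0 < (1 - Real.exp (-l)) * l ^ (-1 - γ) := by
    intro l hl
    have hl' : (0 : ℝ) < l := hl
    have h2 : Real.exp (-l) < 1 := Real.exp_lt_one_iff.2 (by linarith)
    exact mul_pos (by linarith) (Real.rpow_pos_of_pos hl' _)
  rw [setIntegral_pos_iff_support_of_nonneg_ae ?_ (integrableOn_one_sub_exp_mul_rpow h0 h1)]
  · refine lt_of_lt_of_le ?_ (measure_mono (s := Set.Ioi (0 : ℝ)) fun l hl => ⟨(hpos l hl).ne', hl⟩)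
    simp
  · filter_upwards [ae_restrict_mem measurableSet_Ioi] with l hl
    exact (hpos l hl).le

/-- The Lévy density of `t s^γ` has infinite mass at `0`. Cut off there, it has finite mass and the
exponential factors as `exp(-∫ w) * exp(∫ exp(-l s) w)`, a positive constant times the exponential
of a Laplace transform. The cutoff is then removed by a limit bounded by `1`. -/
theorem isRadialPositive_exp_neg_rpow {γ : ℝ} (h0 : 0 < γ) (h1 : γ < 1) {t : ℝ} (ht : 0 ≤ t) :
    IsRadialPositive V fun s => Real.exp (-(t * s ^ γ)) := by
  set K := ∫ l in Set.Ioi (0 : ℝ), (1 - Real.exp (-l)) * l ^ (-1 - γ) with hK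
  have hKpos : 0 < K := integral_one_sub_exp_mul_rpow_pos h0 h1
  -- Normalizes the Lévy density so that its exponent is exactly `t * s ^ γ`.
  set c := t / K with hc
  have hc0 : 0 ≤ c := div_nonneg ht hKpos.le
  let w : ℝ → ℝ := fun l => c * l ^ (-1 - γ)
  have hwm : Measurable w := by fun_prop
  let A : ℕ → Set ℝ := fun n => Set.Ioi (1 / ((n : ℝ) + 1))
  have hApos : ∀ n : ℕ, (0 : ℝ) < 1 / ((n : ℝ) + 1) := fun n => by positivity
  have hAl : ∀ n, ∀ l ∈ A n, (0 : ℝ) < l := fun n l hl => (hApos n).trans hl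
  have hw : ∀ n, IntegrableOn w (A n) := fun n =>
    (integrableOn_Ioi_rpow_of_lt (a := -1 - γ) (by linarith) (hApos n)).const_mul c
  have hw0 : ∀ n, ∀ᵐ l ∂(volume.restrict (A n)), 0 ≤ w l := fun n => by
    filter_upwards [ae_restrict_mem measurableSet_Ioi] with l hl
    exact mul_nonneg hc0 (Real.rpow_nonneg (hAl n l hl).le _)
  have hl0 : ∀ n, ∀ᵐ l ∂(volume.restrict (A n)), 0 ≤ l := fun n => by
    filter_upwards [ae_restrict_mem measurableSet_Ioi] with l hl
    exact (hAl n l hl).le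
  have hwe : ∀ n s, 0 ≤ s → IntegrableOn (fun l => Real.exp (-l * s) * w l) (A n) := by
    intro n s hs
    refine Integrable.mono' (hw n) (by fun_prop) ?_
    filter_upwards [hw0 n, hl0 n] with l h2 h3
    rw [norm_mul, Real.norm_eq_abs, Real.norm_eq_abs, Real.abs_exp, abs_of_nonneg h2]
    refine mul_le_of_le_one_left h2 (Real.exp_le_one_iff.2 ?_)
    nlinarith
  have hdiff : ∀ n s, 0 ≤ s → (∫ l in A n, w l) - ∫ l in A n, Real.exp (-l * s) * w l =
      c * ∫ l in A n, (1 - Real.exp (-l * s)) * l ^ (-1 - γ) := by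
    intro n s hs
    rw [← integral_sub (hw n) (hwe n s hs), ← integral_const_mul]
    refine integral_congr_ae (Eventually.of_forall fun l => ?_)
    simp only [w]
    ring
  have hU : ⋃ n, A n = Set.Ioi (0 : ℝ) := by
    ext l
    simp only [Set.mem_iUnion, Set.mem_Ioi, A]
    exact ⟨fun ⟨n, hn⟩ => (hApos n).trans hn, fun hl => exists_nat_one_div_lt hl⟩
  have hmono : Monotone A := fun i j hij =>
    Set.Ioi_subset_Ioi (one_div_le_one_div_of_le (by positivity) (by gcongr))
  refine IsRadialPositive.of_tendsto (C := 1)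
    (h := fun n s => Real.exp (-∫ l in A n, w l) *
      Real.exp (∫ l in A n, Real.exp (-l * s) * w l))
    (fun n => (IsRadialPositive.exp_laplace _ hwm (hw n) (hw0 n) (hl0 n)).const_mul
      (Real.exp_pos _).le) (by fun_prop) (fun n s hs => ?_) (fun s hs => ?_)
  · rw [← Real.exp_add, Real.abs_exp, Real.exp_le_one_iff]
    have := (le_abs_self _).trans
      (IsRadialPositive.abs_laplace_le _ (hw n) (hw0 n) (hl0 n) s hs)
    linarith
  · have hint : IntegrableOn (fun l : ℝ => (1 - Real.exp (-l * s)) * l ^ (-1 - γ))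
        (⋃ n, A n) := by
      rw [hU]
      rcases hs.eq_or_lt with rfl | hs
      · simp
      have h2 := (integrableOn_Ioi_comp_mul_left_iff
        (fun l : ℝ => (1 - Real.exp (-l)) * l ^ (-1 - γ)) 0 hs).2
        (by rw [mul_zero]; exact integrableOn_one_sub_exp_mul_rpow h0 h1)
      refine (IntegrableOn.congr_fun (h2.const_mul (s ^ (1 + γ))) (fun l hl => ?_)
        measurableSet_Ioi)
      rw [Real.mul_rpow hs.le (le_of_lt hl), neg_mul, mul_comm l s]
      have h3 : s ^ (1 + γ) * s ^ (-1 - γ) = 1 := by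
        rw [← Real.rpow_add hs, show 1 + γ + (-1 - γ) = 0 by ring, Real.rpow_zero]
      linear_combination (1 - Real.exp (-(s * l))) * l ^ (-1 - γ) * h3
    have hlim := tendsto_setIntegral_of_monotone (fun n => measurableSet_Ioi) hmono hint
    rw [hU, integral_one_sub_exp_mul_rpow h0 hs, ← hK] at hlim
    have h2 := (Real.continuous_exp.tendsto _).comp (hlim.const_mul c).neg
    have h3 : -(c * (s ^ γ * K)) = -(t * s ^ γ) := by
      rw [hc]; field_simp
    rw [h3] at h2
    refine h2.congr fun n => ?_
    simp only [Function.comp_apply]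
    rw [← hdiff n s hs, ← Real.exp_add]
    congr 1
    ring

end PositiveDefinite

/-! ### The stable density: positivity, sup bound and mass. -/

section StableDensity

theorem integrable_exp_neg_mul_norm_rpow {V : Type*} [NormedAddCommGroup V] [NormedSpace ℝ V]
    [FiniteDimensional ℝ V] [MeasurableSpace V] [BorelSpace V] [Nontrivial V] (μ : Measure V)
    [μ.IsAddHaarMeasure] {α t : ℝ} (hα : 0 < α) (ht : 0 < t) :
    Integrable (fun y : V => Real.exp (-(t * ‖y‖ ^ α))) μ := by
  rw [integrable_fun_norm_addHaar μ (f := fun r => Real.exp (-(t * r ^ α)))]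
  have h := integrableOn_rpow_mul_exp_neg_mul_rpow (p := α)
    (s := ((Module.finrank ℝ V - 1 : ℕ) : ℝ)) (b := t)
    (by have : (0 : ℝ) ≤ ((Module.finrank ℝ V - 1 : ℕ) : ℝ) := Nat.cast_nonneg _
        linarith) hα ht
  refine h.congr_fun (fun r _ => ?_) measurableSet_Ioi
  simp only [smul_eq_mul, Real.rpow_natCast, neg_mul]

/-- Scaling by `t ^ (1 / α)`; the resulting Jacobian is the source of the exponent `-d/α` in the sup
bound on the density. -/
theorem integral_exp_neg_mul_norm_rpow {V : Type*} [NormedAddCommGroup V] [NormedSpace ℝ V]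
    [FiniteDimensional ℝ V] [MeasurableSpace V] [BorelSpace V] (μ : Measure V)
    [μ.IsAddHaarMeasure] {α t : ℝ} (hα : 0 < α) (ht : 0 < t) :
    ∫ y : V, Real.exp (-(t * ‖y‖ ^ α)) ∂μ =
      t ^ (-((Module.finrank ℝ V : ℝ) / α)) * ∫ y : V, Real.exp (-‖y‖ ^ α) ∂μ := by
  have h := Measure.integral_comp_smul μ (fun y : V => Real.exp (-‖y‖ ^ α)) (t ^ (1 / α))
  have h1 : ∀ y : V, ‖t ^ (1 / α) • y‖ ^ α = t * ‖y‖ ^ α := by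
    intro y
    rw [norm_smul, Real.norm_of_nonneg (by positivity), Real.mul_rpow (by positivity)
      (norm_nonneg _), ← Real.rpow_mul ht.le, one_div_mul_cancel hα.ne', Real.rpow_one]
  simp only [h1, smul_eq_mul] at h
  rw [h, abs_of_nonneg (by positivity), ← Real.rpow_natCast, ← Real.rpow_mul ht.le,
    ← Real.rpow_neg ht.le]
  congr 2
  ring

variable {d : ℕ} {α t : ℝ}

theorem measurable_stableDensity (d : ℕ) (α : ℝ) :
    Measurable (Function.uncurry (stableDensity d α)) := by
  have h : StronglyMeasurable (Function.uncurry
      fun (q : ℝ × EuclideanSpace ℝ (Fin d)) (y : EuclideanSpace ℝ (Fin d)) =>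
        Complex.exp (-(Complex.I * ((inner ℝ q.2 y : ℝ) : ℂ))) *
        ((Real.exp (-(q.1 * ‖y‖ ^ α)) : ℝ) : ℂ)) := by
    refine Measurable.stronglyMeasurable ?_
    unfold Function.uncurry
    fun_prop
  exact (Complex.measurable_re.comp h.integral_prod_right.measurable).const_mul _

theorem stableDensity_eq (hd : 1 ≤ d) (hα : 0 < α) (ht : 0 < t)
    (x : EuclideanSpace ℝ (Fin d)) :
    stableDensity d α t x = ((2 * Real.pi) ^ d)⁻¹ *
      ∫ y : EuclideanSpace ℝ (Fin d), Real.exp (-(t * ‖y‖ ^ α)) * Real.cos (inner ℝ x y) := by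
  have : Nonempty (Fin d) := ⟨⟨0, hd⟩⟩
  unfold stableDensity
  congr 1
  have hn : ∀ y : EuclideanSpace ℝ (Fin d),
      ‖Complex.exp (-(Complex.I * ((inner ℝ x y : ℝ) : ℂ)))‖ = 1 := by
    intro y
    rw [mul_comm, ← neg_mul, ← Complex.ofReal_neg, Complex.norm_exp_ofReal_mul_I]
  have hint : Integrable fun y : EuclideanSpace ℝ (Fin d) =>
      Complex.exp (-(Complex.I * ((inner ℝ x y : ℝ) : ℂ))) *
        ((Real.exp (-(t * ‖y‖ ^ α)) : ℝ) : ℂ) := by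
    refine (integrable_exp_neg_mul_norm_rpow volume hα ht).mono' (by fun_prop)
      (Eventually.of_forall fun y => ?_)
    rw [norm_mul, hn, one_mul, Complex.norm_real, Real.norm_of_nonneg (Real.exp_pos _).le]
  have h1 := integral_re (𝕜 := ℂ) hint
  simp only [RCLike.re_eq_complex_re] at h1
  rw [← h1]
  refine integral_congr_ae (Eventually.of_forall fun y => ?_)
  simp only
  rw [Complex.re_mul_ofReal, mul_comm, mul_comm Complex.I, ← neg_mul _ Complex.I,
    ← Complex.ofReal_neg,
    Complex.exp_ofReal_mul_I_re, Real.cos_neg]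

theorem stableDensity_nonneg (hd : 1 ≤ d) (hα : 0 < α) (hα2 : α ≤ 2) (ht : 0 < t)
    (x : EuclideanSpace ℝ (Fin d)) : 0 ≤ stableDensity d α t x := by
  have : Nonempty (Fin d) := ⟨⟨0, hd⟩⟩
  rw [stableDensity_eq hd hα ht]
  refine mul_nonneg (by positivity) ?_
  -- At `α = 2` the Bernstein argument would need `γ = 1`, but there the integrand is itself
  -- Gaussian: take `h = 1` and `δ = t`. For `α < 2` take `γ = α / 2` and let the Gaussian
  -- regularization tend to `1`.
  rcases hα2.eq_or_lt with rfl | hα2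
  · have h := (IsRadialPositive.one (V := EuclideanSpace ℝ (Fin d))).nonneg t ht x
    simpa using h
  · have h : ∀ n : ℕ, 0 ≤ ∫ y : EuclideanSpace ℝ (Fin d), Real.exp (-(t * ‖y‖ ^ α)) *
        Real.exp (-(1 / ((n : ℝ) + 1)) * ‖y‖ ^ 2) * Real.cos (inner ℝ x y) := by
      intro n
      have h1 := (isRadialPositive_exp_neg_rpow (V := EuclideanSpace ℝ (Fin d)) (γ := α / 2)
        (by linarith) (by linarith) ht.le).nonneg (1 / ((n : ℝ) + 1)) (by positivity) x
      have h2 : ∀ y : EuclideanSpace ℝ (Fin d), (‖y‖ ^ 2) ^ (α / 2) = ‖y‖ ^ α := by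
        intro y
        rw [← Real.rpow_natCast, ← Real.rpow_mul (norm_nonneg _)]
        congr 1
        push_cast; ring
      simpa only [h2] using h1
    refine ge_of_tendsto' (tendsto_integral_of_dominated_convergence
      (fun y : EuclideanSpace ℝ (Fin d) => Real.exp (-(t * ‖y‖ ^ α))) (fun n => by fun_prop)
      (integrable_exp_neg_mul_norm_rpow volume hα ht)
      (fun n => Eventually.of_forall fun y => ?_) (Eventually.of_forall fun y => ?_)) h
    · rw [norm_mul, norm_mul, Real.norm_eq_abs, Real.norm_eq_abs, Real.norm_eq_abs,
        Real.abs_exp, Real.abs_exp, mul_assoc]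
      refine mul_le_of_le_one_right (Real.exp_pos _).le (mul_le_one₀ ?_ (abs_nonneg _)
        (Real.abs_cos_le_one _))
      rw [Real.exp_le_one_iff, neg_mul, neg_nonpos]
      positivity
    · have h1 := (tendsto_one_div_add_atTop_nhds_zero_nat (𝕜 := ℝ)).neg.mul_const (‖y‖ ^ 2)
      have h2 := ((Real.continuous_exp.tendsto _).comp h1).const_mul (Real.exp (-(t * ‖y‖ ^ α)))
      simpa using h2.mul_const (Real.cos (inner ℝ x y))

theorem stableDensity_le (hd : 1 ≤ d) (hα : 0 < α) (ht : 0 < t)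
    (x : EuclideanSpace ℝ (Fin d)) :
    stableDensity d α t x ≤ (((2 * Real.pi) ^ d)⁻¹ *
      ∫ y : EuclideanSpace ℝ (Fin d), Real.exp (-‖y‖ ^ α)) * t ^ (-((d : ℝ) / α)) := by
  have : Nonempty (Fin d) := ⟨⟨0, hd⟩⟩
  rw [stableDensity_eq hd hα ht, mul_assoc]
  refine mul_le_mul_of_nonneg_left ?_ (by positivity)
  have h := integral_exp_neg_mul_norm_rpow
    (volume : Measure (EuclideanSpace ℝ (Fin d))) hα ht
  rw [finrank_euclideanSpace_fin] at h
  rw [mul_comm, ← h]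
  refine (le_abs_self _).trans ?_
  rw [← Real.norm_eq_abs]
  refine norm_integral_le_of_norm_le (integrable_exp_neg_mul_norm_rpow volume hα ht)
    (Eventually.of_forall fun y => ?_)
  rw [norm_mul, Real.norm_eq_abs, Real.norm_eq_abs, Real.abs_exp]
  exact mul_le_of_le_one_right (Real.exp_pos _).le (Real.abs_cos_le_one _)

theorem integrable_stableDensity_mul_exp (hd : 1 ≤ d) (hα : 0 < α) (hα2 : α ≤ 2) (ht : 0 < t)
    {δ : ℝ} (hδ : 0 < δ) :
    Integrable fun x : EuclideanSpace ℝ (Fin d) =>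
      stableDensity d α t x * Real.exp (-δ * ‖x‖ ^ 2) := by
  have hm : Measurable (stableDensity d α t) :=
    (measurable_stableDensity d α).of_uncurry_left
  refine ((integrable_exp_neg_mul_sq_norm hδ).const_mul ((((2 * Real.pi) ^ d)⁻¹ *
    ∫ y : EuclideanSpace ℝ (Fin d), Real.exp (-‖y‖ ^ α)) * t ^ (-((d : ℝ) / α)))).mono' (by fun_prop)
    (Eventually.of_forall fun x => ?_)
  rw [norm_mul, Real.norm_of_nonneg (stableDensity_nonneg hd hα hα2 ht x),
    Real.norm_of_nonneg (Real.exp_pos _).le]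
  exact mul_le_mul_of_nonneg_right (stableDensity_le hd hα ht x) (Real.exp_pos _).le

/-- The Gaussian weight makes Fubini legitimate. Integrating over `x` first leaves a Gaussian in
`y`, and bounding `exp(-t ‖y‖^α)` by `1` leaves its total mass `(2π)^d`, which cancels the
normalization. No Fourier inversion theorem is needed. -/
theorem integral_stableDensity_mul_exp_le_one (hd : 1 ≤ d) (hα : 0 < α) (ht : 0 < t)
    {δ : ℝ} (hδ : 0 < δ) :
    ∫ x : EuclideanSpace ℝ (Fin d), stableDensity d α t x * Real.exp (-δ * ‖x‖ ^ 2) ≤ 1 := by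
  have : Nonempty (Fin d) := ⟨⟨0, hd⟩⟩
  let f : EuclideanSpace ℝ (Fin d) → EuclideanSpace ℝ (Fin d) → ℝ := fun x y =>
    Real.exp (-(t * ‖y‖ ^ α)) * (Real.exp (-δ * ‖x‖ ^ 2) * Real.cos (inner ℝ y x))
  have h1 : ∀ x : EuclideanSpace ℝ (Fin d),
      stableDensity d α t x * Real.exp (-δ * ‖x‖ ^ 2) =
        ((2 * Real.pi) ^ d)⁻¹ * ∫ y, f x y := by
    intro x
    rw [stableDensity_eq hd hα ht, mul_assoc, ← integral_mul_const]
    congr 1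
    refine integral_congr_ae (Eventually.of_forall fun y => ?_)
    simp only [f, real_inner_comm]
    ring
  have hf : Integrable (Function.uncurry f) (volume.prod volume) := by
    refine ((integrable_exp_neg_mul_sq_norm (V := EuclideanSpace ℝ (Fin d)) hδ).mul_prod
      (integrable_exp_neg_mul_norm_rpow
        (volume : Measure (EuclideanSpace ℝ (Fin d))) hα ht)).mono' ?_
      (Eventually.of_forall fun z => ?_)
    · refine Measurable.aestronglyMeasurable ?_
      unfold Function.uncurry
      simp only [f]
      fun_prop
    · simp only [Function.uncurry, f, norm_mul, Real.norm_eq_abs, Real.abs_exp]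
      rw [mul_comm, mul_right_comm, mul_comm _ (Real.exp (-(t * ‖z.2‖ ^ α)))]
      exact mul_le_of_le_one_right (by positivity) (Real.abs_cos_le_one _)
  have hπ := Real.pi_pos
  simp only [h1]
  rw [integral_const_mul, integral_integral_swap hf]
  simp only [f, integral_const_mul, integral_exp_neg_mul_sq_norm_mul_cos hδ]
  have hδ4 : 0 < (4 * δ)⁻¹ := by positivity
  have h2 : ∫ y : EuclideanSpace ℝ (Fin d), Real.exp (-(t * ‖y‖ ^ α)) *
      ((Real.pi / δ) ^ ((Module.finrank ℝ (EuclideanSpace ℝ (Fin d)) : ℝ) / 2) *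
        Real.exp (-(4 * δ)⁻¹ * ‖y‖ ^ 2)) ≤
      ∫ y : EuclideanSpace ℝ (Fin d),
      (Real.pi / δ) ^ ((Module.finrank ℝ (EuclideanSpace ℝ (Fin d)) : ℝ) / 2) *
        Real.exp (-(4 * δ)⁻¹ * ‖y‖ ^ 2) := by
    have hi := (integrable_exp_neg_mul_sq_norm (V := EuclideanSpace ℝ (Fin d)) hδ4).const_mul
      ((Real.pi / δ) ^ ((Module.finrank ℝ (EuclideanSpace ℝ (Fin d)) : ℝ) / 2))
    refine integral_mono_of_nonneg (Eventually.of_forall fun y => ?_) hi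
      (Eventually.of_forall fun y => ?_)
    · simp only [Pi.zero_apply]; positivity
    · refine mul_le_of_le_one_left (by positivity) (Real.exp_le_one_iff.2 ?_)
      rw [neg_nonpos]; positivity
  rw [integral_const_mul, GaussianFourier.integral_rexp_neg_mul_sq_norm hδ4,
    finrank_euclideanSpace_fin, ← Real.mul_rpow (by positivity) (by positivity)] at h2
  have h3 : Real.pi / δ * (Real.pi / (4 * δ)⁻¹) = (2 * Real.pi) ^ (2 : ℝ) := by
    rw [Real.rpow_two]; field_simp; ring
  rw [h3, ← Real.rpow_mul (by positivity), mul_div_cancel₀ _ (two_ne_zero),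
    Real.rpow_natCast] at h2
  rw [finrank_euclideanSpace_fin]
  calc _ ≤ ((2 * Real.pi) ^ d)⁻¹ * (2 * Real.pi) ^ d :=
        mul_le_mul_of_nonneg_left h2 (by positivity)
    _ = 1 := inv_mul_cancel₀ (by positivity)

/-- Fatou's lemma as the Gaussian weight tends to `1`. -/
theorem lintegral_stableDensity_le_one (hd : 1 ≤ d) (hα : 0 < α) (hα2 : α ≤ 2) (ht : 0 < t) :
    ∫⁻ x, ENNReal.ofReal (stableDensity d α t x) ≤ 1 := by
  have hm : Measurable (stableDensity d α t) :=
    (measurable_stableDensity d α).of_uncurry_left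
  let F : ℕ → EuclideanSpace ℝ (Fin d) → ENNReal := fun n x =>
    ENNReal.ofReal (stableDensity d α t x * Real.exp (-(1 / ((n : ℝ) + 1)) * ‖x‖ ^ 2))
  have hlim : ∀ x, liminf (fun n => F n x) atTop = ENNReal.ofReal (stableDensity d α t x) := by
    intro x
    refine Tendsto.liminf_eq (ENNReal.tendsto_ofReal ?_)
    have h1 := (tendsto_one_div_add_atTop_nhds_zero_nat (𝕜 := ℝ)).neg.mul_const (‖x‖ ^ 2)
    have h2 := ((Real.continuous_exp.tendsto _).comp h1).const_mul (stableDensity d α t x)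
    simpa using h2
  have h := lintegral_liminf_le (μ := volume) (f := F) (u := atTop) (fun n => by fun_prop)
  simp only [hlim] at h
  refine h.trans (liminf_le_of_le (by isBoundedDefault) fun b hb => ?_)
  obtain ⟨n, hn⟩ := hb.exists
  refine hn.trans ?_
  have hδ : (0 : ℝ) < 1 / ((n : ℝ) + 1) := by positivity
  rw [← ofReal_integral_eq_lintegral_ofReal
    (integrable_stableDensity_mul_exp hd hα hα2 ht hδ)
    (Eventually.of_forall fun x => mul_nonneg (stableDensity_nonneg hd hα hα2 ht x)
      (Real.exp_pos _).le)]
  exact ENNReal.ofReal_le_one.2 (integral_stableDensity_mul_exp_le_one hd hα ht hδ)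

end StableDensity

/-! ### Power integrability of the occupation density. -/

section Occupation

variable {X : Type*} [MeasurableSpace X] {μ : Measure X} {p : ℝ → X → ℝ} {C κ b : ℝ}

theorem lintegral_ofReal_rpow_Ioc_lt_top {s : ℝ} (hs : -1 < s) (T : ℝ) :
    ∫⁻ u in Set.Ioc 0 T, ENNReal.ofReal (u ^ s) < ⊤ := by
  rcases le_total T 0 with hT | hT
  · simp [Set.Ioc_eq_empty_of_le hT]
  exact ((intervalIntegrable_iff_integrableOn_Ioc_of_le hT).1
    (intervalIntegral.intervalIntegrable_rpow' hs)).lintegral_lt_top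

/-- The occupation density `∫_0^T p_u(x) du`. -/
def occupationDensity (p : ℝ → X → ℝ) (T : ℝ) (x : X) : ENNReal :=
  ∫⁻ u in Set.Ioc 0 T, ENNReal.ofReal (p u x)

theorem measurable_occupationDensity (hp : Measurable (Function.uncurry p)) (T : ℝ) :
    Measurable (occupationDensity p T) := by
  refine Measurable.lintegral_prod_right (f := fun x u => ENNReal.ofReal (p u x)) ?_
  exact ENNReal.measurable_ofReal.comp (hp.comp measurable_swap)

/-- Hölder in `u` applied to `p_u = u^(-σ) * (u^σ p_u)`, followed by Tonelli. The sup bound handles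
`p_u^(b-1)` and the mass bound the remaining factor `p_u`, which leaves `∫ u^(σb - κ(b-1)) du`. -/
theorem lintegral_occupationDensity_rpow_lt_top [SFinite μ]
    (hp : Measurable (Function.uncurry p)) (hC : 0 ≤ C)
    (hp0 : ∀ u, 0 < u → ∀ x, 0 ≤ p u x) (hpC : ∀ u, 0 < u → ∀ x, p u x ≤ C * u ^ (-κ))
    (hp1 : ∀ u, 0 < u → ∫⁻ x, ENNReal.ofReal (p u x) ∂μ ≤ 1)
    (hb : 1 < b) (hκ : κ * (b - 1) < b) (T : ℝ) :
    ∫⁻ x, occupationDensity p T x ^ b ∂μ < ⊤ := by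
  have hb0 : 0 < b := by linarith
  set q := b / (b - 1) with hq
  have hconj : q.HolderConjugate b := (Real.HolderConjugate.conjExponent hb).symm
  -- The upper bound says `σq < 1`, so `u^(-σq)` is integrable at `0`; the lower one says `σb -
  -- κ(b-1) > -1`. They are compatible exactly when `κ(b-1) < b`.
  obtain ⟨σ, h1, h2⟩ : ∃ σ, (κ * (b - 1) - 1) / b < σ ∧ σ < (b - 1) / b :=
    exists_between (by gcongr)
  rw [div_lt_iff₀ hb0] at h1
  have hσq : σ * q < 1 := by
    rw [hq, ← mul_div_assoc, div_lt_one (by linarith)]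
    rwa [lt_div_iff₀ hb0] at h2
  let f : ℝ → ENNReal := fun u => ENNReal.ofReal (u ^ (-σ))
  let g : X → ℝ → ENNReal := fun x u => ENNReal.ofReal (u ^ σ * p u x)
  have hgm : Measurable (Function.uncurry g) := by
    refine ENNReal.measurable_ofReal.comp ?_
    exact (measurable_snd.pow_const σ).mul (hp.comp measurable_swap)
  set A := (∫⁻ u in Set.Ioc 0 T, f u ^ q) ^ (1 / q) with hA
  have hAtop : A < ⊤ := by
    refine ENNReal.rpow_lt_top_of_nonneg (by have := hconj.nonneg; positivity) (ne_of_lt ?_)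
    refine lt_of_eq_of_lt (setLIntegral_congr_fun measurableSet_Ioc fun u hu => ?_)
      (lintegral_ofReal_rpow_Ioc_lt_top (s := -(σ * q)) (by linarith) T)
    simp only [f]
    rw [ENNReal.ofReal_rpow_of_nonneg (Real.rpow_nonneg hu.1.le _) hconj.nonneg,
      ← Real.rpow_mul hu.1.le, neg_mul]
  have hG : ∀ x, occupationDensity p T x ^ b ≤
      A ^ b * ∫⁻ u in Set.Ioc 0 T, g x u ^ b := by
    intro x
    have hH := ENNReal.lintegral_mul_le_Lp_mul_Lq (volume.restrict (Set.Ioc 0 T)) hconj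
      (f := f) (g := g x) (by fun_prop) (hgm.of_uncurry_left.aemeasurable)
    have he : ∫⁻ u in Set.Ioc 0 T, (f * g x) u = occupationDensity p T x := by
      refine setLIntegral_congr_fun measurableSet_Ioc fun u hu => ?_
      simp only [Pi.mul_apply, f, g]
      rw [← ENNReal.ofReal_mul (Real.rpow_nonneg hu.1.le _), ← mul_assoc,
        ← Real.rpow_add hu.1, neg_add_cancel, Real.rpow_zero, one_mul]
    rw [he] at hH
    calc occupationDensity p T x ^ b
        ≤ (A * (∫⁻ u in Set.Ioc 0 T, g x u ^ b) ^ (1 / b)) ^ b :=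
          ENNReal.rpow_le_rpow hH hb0.le
      _ = _ := by
          rw [ENNReal.mul_rpow_of_nonneg _ _ hb0.le, ← ENNReal.rpow_mul (∫⁻ u in _, g x u ^ b),
            one_div_mul_cancel hb0.ne', ENNReal.rpow_one]
  refine (lintegral_mono hG).trans_lt ?_
  rw [lintegral_const_mul' _ _ (ENNReal.rpow_ne_top_of_nonneg hb0.le hAtop.ne)]
  refine ENNReal.mul_lt_top (ENNReal.rpow_lt_top_of_nonneg hb0.le hAtop.ne) ?_
  rw [lintegral_lintegral_swap (hgm.pow_const b).aemeasurable]
  have hin : ∀ u ∈ Set.Ioc 0 T, ∫⁻ x, g x u ^ b ∂μ ≤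
      ENNReal.ofReal (C ^ (b - 1)) * ENNReal.ofReal (u ^ (σ * b - κ * (b - 1))) := by
    intro u hu
    have hu0 : 0 < u := hu.1
    rw [← ENNReal.ofReal_mul (by positivity)]
    have hle : ∀ x, g x u ^ b ≤
        ENNReal.ofReal (C ^ (b - 1) * u ^ (σ * b - κ * (b - 1))) * ENNReal.ofReal (p u x) := by
      intro x
      have hpx := hp0 u hu0 x
      simp only [g]
      rw [ENNReal.ofReal_rpow_of_nonneg (by positivity) hb0.le,
        ← ENNReal.ofReal_mul (by positivity)]
      refine ENNReal.ofReal_le_ofReal ?_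
      rw [Real.mul_rpow (by positivity) hpx, ← Real.rpow_mul hu0.le]
      have e1 : p u x ^ b = p u x ^ (b - 1) * p u x := by
        rw [← Real.rpow_add_one' hpx (by linarith)]
        congr 1; ring
      have e2 : p u x ^ (b - 1) ≤ C ^ (b - 1) * u ^ (-(κ * (b - 1))) := by
        rw [← neg_mul, Real.rpow_mul hu0.le, ← Real.mul_rpow hC (by positivity)]
        exact Real.rpow_le_rpow hpx (hpC u hu0 x) (by linarith)
      have e3 : u ^ (σ * b - κ * (b - 1)) = u ^ (σ * b) * u ^ (-(κ * (b - 1))) := by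
        rw [← Real.rpow_add hu0]; rfl
      rw [e1, e3]
      calc u ^ (σ * b) * (p u x ^ (b - 1) * p u x)
          ≤ u ^ (σ * b) * (C ^ (b - 1) * u ^ (-(κ * (b - 1))) * p u x) := by gcongr
        _ = _ := by ring
    refine (lintegral_mono hle).trans ?_
    rw [lintegral_const_mul' _ _ ENNReal.ofReal_ne_top]
    exact mul_le_of_le_one_right' (hp1 u hu0)
  refine (setLIntegral_mono' measurableSet_Ioc hin).trans_lt ?_
  rw [lintegral_const_mul' _ _ ENNReal.ofReal_ne_top]
  exact ENNReal.mul_lt_top ENNReal.ofReal_lt_top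
    (lintegral_ofReal_rpow_Ioc_lt_top (by linarith) T)

theorem ae_integrableOn_Ioc [SFinite μ] (hp : Measurable (Function.uncurry p))
    (hp0 : ∀ u, 0 < u → ∀ x, 0 ≤ p u x)
    (hp1 : ∀ u, 0 < u → ∫⁻ x, ENNReal.ofReal (p u x) ∂μ ≤ 1) (T : ℝ) :
    ∀ᵐ x ∂μ, IntegrableOn (fun u => p u x) (Set.Ioc 0 T) := by
  have h : ∫⁻ x, occupationDensity p T x ∂μ ≠ ⊤ := by
    unfold occupationDensity
    rw [lintegral_lintegral_swap (f := fun x u => ENNReal.ofReal (p u x))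
      (ENNReal.measurable_ofReal.comp (hp.comp measurable_swap)).aemeasurable]
    refine ne_top_of_le_ne_top ?_ (setLIntegral_mono' measurableSet_Ioc fun u hu => hp1 u hu.1)
    simp
  filter_upwards [ae_lt_top (measurable_occupationDensity hp T) h] with x hx
  refine ⟨(hp.comp measurable_prodMk_right).aestronglyMeasurable, ?_⟩
  rw [hasFiniteIntegral_iff_ofReal]
  · exact hx
  · filter_upwards [ae_restrict_mem measurableSet_Ioc] with u hu
    exact hp0 u hu.1 x

/-- The shift turns the integral into one over `(0, t - r]`, and positivity allows enlarging the
range to `(0, t]`, which removes the dependence on `r`. -/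
theorem enorm_integral_shift_le {Y : Type*} {p : ℝ → Y → ℝ} (hp0 : ∀ u, 0 < u → ∀ x, 0 ≤ p u x)
    {r t : ℝ} (hr : r ∈ Set.Icc 0 t) (x : Y) :
    ‖∫ u in r..t, p (u - r) x‖ₑ ≤ occupationDensity p t x := by
  rw [intervalIntegral.integral_comp_sub_right (fun u => p u x) r, sub_self,
    intervalIntegral.integral_of_le (by linarith [hr.2])]
  refine (enorm_integral_le_lintegral_enorm _).trans ?_
  refine (lintegral_mono_set (Set.Ioc_subset_Ioc_right (by linarith [hr.1] : t - r ≤ t))).trans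
    (le_of_eq ?_)
  exact setLIntegral_congr_fun measurableSet_Ioc fun u hu =>
    Real.enorm_eq_ofReal (hp0 u hu.1 x)

/-- The variable limit `r` is moved into an indicator of `r < u ≤ t`, so that joint measurability
follows from that of parameter integrals. -/
theorem measurable_integral_shift (hp : Measurable (Function.uncurry p)) (t : ℝ) :
    Measurable fun q : ℝ × X =>
      (Set.Icc 0 t).indicator (fun r => ∫ u in r..t, p (u - r) q.2) q.1 := by
  have h : StronglyMeasurable (Function.uncurry fun (q : ℝ × X) (u : ℝ) =>
      {z : (ℝ × X) × ℝ | z.1.1 < z.2 ∧ z.2 ≤ t}.indicator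
        (fun z => p (z.2 - z.1.1) z.1.2) (q, u)) := by
    refine (Measurable.indicator ?_ ?_).stronglyMeasurable
    · exact hp.comp ((measurable_snd.sub measurable_fst.fst).prodMk measurable_fst.snd)
    · exact (measurableSet_lt measurable_fst.fst measurable_snd).inter
        (measurableSet_le measurable_snd measurable_const)
  have h2 := (h.integral_prod_right (ν := volume)).measurable.indicator
    (measurable_fst measurableSet_Icc : MeasurableSet {q : ℝ × X | q.1 ∈ Set.Icc 0 t})
  convert h2 using 2 with q
  by_cases hq : q.1 ∈ Set.Icc 0 t
  · rw [Set.indicator_of_mem hq, Set.indicator_of_mem (by exact hq),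
      intervalIntegral.integral_of_le hq.2, ← integral_indicator measurableSet_Ioc]
    rfl
  · rw [Set.indicator_of_notMem hq, Set.indicator_of_notMem (by exact hq)]

end Occupation

/-! ### The two kernels in `L^a`. -/

section Kernels

variable {X : Type*} [MeasurableSpace X] {μ : Measure X} {p : ℝ → X → ℝ}

theorem memLp_indicator_integral_shift [SFinite μ] (hp : Measurable (Function.uncurry p))
    (hp0 : ∀ u, 0 < u → ∀ x, 0 ≤ p u x) {a : ℝ} (ha : 0 < a) (t : ℝ)
    (hG : ∫⁻ x, occupationDensity p t x ^ a ∂μ < ⊤) :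
    MemLp (fun q : ℝ × X =>
      (Set.Icc 0 t).indicator (fun r => ∫ u in r..t, p (u - r) q.2) q.1)
      (ENNReal.ofReal a) (volume.prod μ) := by
  refine ⟨(measurable_integral_shift hp t).aestronglyMeasurable, ?_⟩
  rw [eLpNorm_lt_top_iff_lintegral_rpow_enorm_lt_top (by simpa using ha) (by simp),
    ENNReal.toReal_ofReal ha.le]
  have hle : ∀ q : ℝ × X,
      ‖(Set.Icc 0 t).indicator (fun r => ∫ u in r..t, p (u - r) q.2) q.1‖ₑ ^ a ≤
      (Set.Icc 0 t).indicator 1 q.1 * occupationDensity p t q.2 ^ a := by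
    intro q
    by_cases hq : q.1 ∈ Set.Icc 0 t
    · rw [Set.indicator_of_mem hq, Set.indicator_of_mem hq, Pi.one_apply, one_mul]
      exact ENNReal.rpow_le_rpow (enorm_integral_shift_le hp0 hq q.2) ha.le
    · rw [Set.indicator_of_notMem hq, enorm_zero, ENNReal.zero_rpow_of_pos ha]
      exact zero_le
  refine (lintegral_mono hle).trans_lt ?_
  rw [lintegral_prod_mul ((measurable_one.indicator measurableSet_Icc).aemeasurable)
    ((measurable_occupationDensity hp t).pow_const a).aemeasurable,
    lintegral_indicator_one measurableSet_Icc]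
  exact ENNReal.mul_lt_top (by simp) hG

/-- Nothing is assumed about `p 0`, so the null slice `r = 0` has to be discarded. -/
theorem ae_fst_ne_zero [SFinite μ] : ∀ᵐ q ∂((volume : Measure ℝ).prod μ), q.1 ≠ 0 :=
  Measure.quasiMeasurePreserving_fst.ae
    (show ∀ᵐ r : ℝ, r ≠ 0 by rw [ae_iff]; simp)

/-- The `a`-th power of the kernel is at most `p_r(x) G(x)^a`; integrating over `r` before `x` turns
`p_r(x)` into `G(x)`, whence the exponent `1 + a`. -/
theorem memLp_indicator_rpow_mul_integral_shift [SFinite μ]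
    (hp : Measurable (Function.uncurry p)) (hp0 : ∀ u, 0 < u → ∀ x, 0 ≤ p u x)
    {a : ℝ} (ha : 0 < a) (t : ℝ) (hG : ∫⁻ x, occupationDensity p t x ^ (1 + a) ∂μ < ⊤) :
    MemLp (fun q : ℝ × X =>
      (Set.Icc 0 t).indicator (fun r => p r q.2 ^ (1 / a) * ∫ u in r..t, p (u - r) q.2) q.1)
      (ENNReal.ofReal a) (volume.prod μ) := by
  have hm : Measurable fun q : ℝ × X =>
      (Set.Icc 0 t).indicator (fun r => p r q.2 ^ (1 / a) * ∫ u in r..t, p (u - r) q.2) q.1 := by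
    have h1 : Measurable fun q : ℝ × X => p q.1 q.2 ^ (1 / a) := hp.pow_const _
    convert h1.mul (measurable_integral_shift hp t) using 2 with q
    by_cases hq : q.1 ∈ Set.Icc 0 t
    · simp only [Pi.mul_apply, Set.indicator_of_mem hq]
    · simp only [Pi.mul_apply, Set.indicator_of_notMem hq, mul_zero]
  refine ⟨hm.aestronglyMeasurable, ?_⟩
  rw [eLpNorm_lt_top_iff_lintegral_rpow_enorm_lt_top (by simpa using ha) (by simp),
    ENNReal.toReal_ofReal ha.le]
  let B : ℝ × X → ENNReal := fun q =>
    (Set.Ioc 0 t).indicator (fun r => ENNReal.ofReal (p r q.2)) q.1 *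
      occupationDensity p t q.2 ^ a
  have hle : ∀ᵐ q ∂((volume : Measure ℝ).prod μ),
      ‖(Set.Icc 0 t).indicator
        (fun r => p r q.2 ^ (1 / a) * ∫ u in r..t, p (u - r) q.2) q.1‖ₑ ^ a ≤ B q := by
    filter_upwards [ae_fst_ne_zero] with q hq0
    by_cases hq : q.1 ∈ Set.Icc 0 t
    · have hpos : 0 < q.1 := lt_of_le_of_ne hq.1 hq0.symm
      have hpq := hp0 q.1 hpos q.2
      simp only [B]
      rw [Set.indicator_of_mem hq, Set.indicator_of_mem (show q.1 ∈ Set.Ioc 0 t from ⟨hpos, hq.2⟩), enorm_mul,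
        ENNReal.mul_rpow_of_nonneg _ _ ha.le, Real.enorm_eq_ofReal (Real.rpow_nonneg hpq _),
        ENNReal.ofReal_rpow_of_nonneg (Real.rpow_nonneg hpq _) ha.le, ← Real.rpow_mul hpq,
        one_div_mul_cancel ha.ne', Real.rpow_one]
      gcongr
      exact enorm_integral_shift_le hp0 hq q.2
    · rw [Set.indicator_of_notMem hq, enorm_zero, ENNReal.zero_rpow_of_pos ha]
      exact zero_le
  have hBm : Measurable B := by
    have h1 : Measurable fun q : ℝ × X =>
        (Set.Ioc 0 t).indicator (fun r => ENNReal.ofReal (p r q.2)) q.1 := by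
      have h2 := (ENNReal.measurable_ofReal.comp hp).indicator
        (measurable_fst measurableSet_Ioc : MeasurableSet {q : ℝ × X | q.1 ∈ Set.Ioc 0 t})
      exact h2
    exact h1.mul (((measurable_occupationDensity hp t).comp measurable_snd).pow_const a)
  refine (lintegral_mono_ae hle).trans_lt ?_
  rw [lintegral_prod_symm _ hBm.aemeasurable]
  refine lt_of_eq_of_lt (lintegral_congr fun x => ?_) hG
  simp only [B]
  have hmx : Measurable fun r => ENNReal.ofReal (p r x) :=
    ENNReal.measurable_ofReal.comp (hp.comp measurable_prodMk_right)
  rw [lintegral_mul_const _ (hmx.indicator measurableSet_Ioc),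
    lintegral_indicator measurableSet_Ioc,
    ENNReal.rpow_add_of_nonneg _ _ zero_le_one ha.le, ENNReal.rpow_one]
  rfl

theorem ae_intervalIntegrable_shift [SFinite μ] (hp : Measurable (Function.uncurry p))
    (hp0 : ∀ u, 0 < u → ∀ x, 0 ≤ p u x)
    (hp1 : ∀ u, 0 < u → ∫⁻ x, ENNReal.ofReal (p u x) ∂μ ≤ 1) (t : ℝ) :
    ∀ᵐ q ∂((volume : Measure ℝ).prod μ), q.1 ∈ Set.Icc 0 t →
      IntervalIntegrable (fun u => p (u - q.1) q.2) volume q.1 t := by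
  filter_upwards [Measure.quasiMeasurePreserving_snd.ae (ae_integrableOn_Ioc hp hp0 hp1 t)]
    with q hq hqt
  have h1 : IntervalIntegrable (fun u => p u q.2) volume 0 (t - q.1) := by
    rw [intervalIntegrable_iff_integrableOn_Ioc_of_le (by linarith [hqt.2])]
    exact hq.mono_set (Set.Ioc_subset_Ioc_right (by linarith [hqt.1]))
  simpa using h1.comp_sub_right q.1

end Kernels

end

/-! ### The main theorem. -/

theorem proposition2p1 {Ω : Type*} [MeasurableSpace Ω] (P : Measure Ω) [IsProbabilityMeasure P]
    (d : ℕ) (hd : 1 ≤ d) (α β : ℝ) (hα0 : 0 < α) (hα2 : α ≤ 2) (hβ0 : 0 < β) (hβ1 : β ≤ 1)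
    (M : Set (ℝ × EuclideanSpace ℝ (Fin d)) → Ω → ℝ)
    (hM : IsStableRandomMeasure P volume (1 + β) M) :
    ((d : ℝ) < α * (1 + β) / β →
      (∀ t : ℝ, 0 ≤ t → ∀ᵐ q : ℝ × EuclideanSpace ℝ (Fin d), q.1 ∈ Set.Icc 0 t →
        IntervalIntegrable (fun u => stableDensity d α (u - q.1) q.2) volume q.1 t) ∧
      StableIntegralProcessWellDefined P volume (1 + β) M (fun t => xiKernel d α t)) ∧
    ((d : ℝ) < α * (2 + β) / (1 + β) →
      (∀ t : ℝ, 0 ≤ t → ∀ᵐ q : ℝ × EuclideanSpace ℝ (Fin d), q.1 ∈ Set.Icc 0 t →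
        0 ≤ stableDensity d α q.1 q.2 ∧
        IntervalIntegrable (fun u => stableDensity d α (u - q.1) q.2) volume q.1 t) ∧
      StableIntegralProcessWellDefined P volume (1 + β) M (fun t => zetaKernel d α β t)) := by
  have hm := measurable_stableDensity d α
  have h0 : ∀ u, 0 < u → ∀ x, 0 ≤ stableDensity d α u x :=
    fun u hu x => stableDensity_nonneg hd hα0 hα2 hu x
  have h1 : ∀ u, 0 < u → ∫⁻ x, ENNReal.ofReal (stableDensity d α u x) ≤ 1 :=
    fun u hu => lintegral_stableDensity_le_one hd hα0 hα2 hu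
  have hC : 0 ≤ ((2 * Real.pi) ^ d)⁻¹ *
      ∫ y : EuclideanSpace ℝ (Fin d), Real.exp (-‖y‖ ^ α) := by
    have : 0 ≤ ∫ y : EuclideanSpace ℝ (Fin d), Real.exp (-‖y‖ ^ α) :=
      integral_nonneg fun y => (Real.exp_pos _).le
    have := Real.pi_pos
    positivity
  have hle : ∀ u, 0 < u → ∀ x : EuclideanSpace ℝ (Fin d), stableDensity d α u x ≤ _ :=
    fun u hu x => stableDensity_le hd hα0 hu x
  have hint := fun t => ae_intervalIntegrable_shift hm h0 h1 t
  have ha : 0 < 1 + β := by linarith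
  refine ⟨fun hdim => ⟨fun t _ => hint t, ?_⟩, fun hdim => ⟨fun t _ => ?_, ?_⟩⟩
  · refine stableIntegralProcessWellDefined_of_memLp ha hM fun t _ => ?_
    refine memLp_indicator_integral_shift hm h0 ha t
      (lintegral_occupationDensity_rpow_lt_top hm hC h0 hle h1 (by linarith) ?_ t)
    -- Here `κ = d/α` and `b = 1 + β`: the required inequality is `(d/α) β < 1 + β`.
    rw [lt_div_iff₀ hβ0] at hdim
    rw [add_sub_cancel_left, div_mul_eq_mul_div, div_lt_iff₀ hα0]
    linarith
  · filter_upwards [hint t, ae_fst_ne_zero] with q h2 h3 hq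
    exact ⟨h0 _ (lt_of_le_of_ne hq.1 h3.symm) _, h2 hq⟩
  · refine stableIntegralProcessWellDefined_of_memLp ha hM fun t _ => ?_
    refine memLp_indicator_rpow_mul_integral_shift hm h0 ha t
      (lintegral_occupationDensity_rpow_lt_top hm hC h0 hle h1 (by linarith) ?_ t)
    -- Now `b = 1 + (1 + β)`: the required inequality is `(d/α)(1 + β) < 2 + β`.
    rw [lt_div_iff₀ ha] at hdim
    rw [add_sub_cancel_left, div_mul_eq_mul_div, div_lt_iff₀ hα0]
    linarith
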